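/- **Conventions.** A *Hilbert algebra* is an algebra $(H,\to,1)$ such that $a\to(b\to a)=1$, $(a\to(b\to c))\to((a\to b)\to(a\to c))=1$, and $a\to b=b\to a=1$ implies $a=b$. Its natural order is $a\le b\iff a\to b=1$. It is *prelinear* if $((a\to b)\to c)\to(((b\to a)\to c)\to c)=1$ for all $a,b,c$, and *bounded* if it has a named least element $0$. $\mathsf{PHil}_0$ is the class of bounded prelinear Hilbert algebras. An *implicative filter* is a set $F\ni 1$ with $b\in F$ whenever $a,\,a\to b\in F$. It is *irreducible* if it is proper and $F=F_1\cap F_2$ with $F_1,F_2$ implicative filters implies $F=F_1$ or $F=F_2$. $X(H)$ is the set of irreducible implicative filters ordered by inclusion (for a Heyting algebra these are the prime filters), and $\varphi(a)=\{P\in X(H):a\in P\}$. A poset is a *root system* if the elements above any given element form a chain. An *$H$-space* is $(X,\tau,\mathcal K)$, where $(X,\tau)$ is a sober topological space, $\mathcal K$ is a base of compact open sets for $\tau$, and $\mathrm{sat}(U\cap V^c)\in\mathcal K$ for all $U,V\in\mathcal K$, with $\mathrm{sat}(Y)$ the intersection of all open sets containing $Y$. Put $x\le_d y\iff y\in\overline{\{x\}}$.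 The objects of the category $\mathsf{PHS}_0$ are the $H$-spaces with $X\in\mathcal K$ for which $(X,\le_d)$ is a root system. Its morphisms $(X_1,\mathcal K_1)\to(X_2,\mathcal K_2)$ are the relations $R\subseteq X_1\times X_2$ such that: $\{x:R(x)\cap U\ne\emptyset\}\in\mathcal K_1$ for all $U\in\mathcal K_2$; every $R(x)$ is closed and non-empty; and if $(x,y)\in R$, then $R(z)=\overline{\{y\}}$ for some $z\in\overline{\{x\}}$. Composition is composition of relations, and the identities are the relations $\le_d$. For $H\in\mathsf{PHil}_0$, $\mathbf X(H)$ denotes the object of $\mathsf{PHS}_0$ on $X(H)$ with $\mathcal K_H=\{\varphi(a)^c:a\in H\}$ and the topology generated by $\mathcal K_H$. Let $H^*$ be the Heyting subalgebra generated by $\varphi(H)$ in the Heyting algebra of upsets of $X(H)$; it is a prelinear Heyting algebra. $\mathsf{Esa}_p$ is the category of Esakia spaces that are root systems, with continuous p-morphisms, and $\mathbf X(H^*)$ is the Esakia space of $H^*$: its prime filters, ordered by inclusion, with the topology generated by the sets $\varphi(u)$ and $\varphi(u)^c$, $u\in H^*$. **Theorem.** Let $H$ and $G$ be finite algebras in $\mathsf{PHil}_0$.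 Then the products $\mathbf X(H^*)\prod_{\mathsf{Esa}_p}\mathbf X(G^*)$ and $\mathbf X(H)\prod_{\mathsf{PHS}_0}\mathbf X(G)$ exist. Moreover, there are a topology $\tau$ and a family $\mathcal K$ of subsets of $\mathbf X(H^*)\prod_{\mathsf{Esa}_p}\mathbf X(G^*)$, with $\tau$ the set of all downsets of the order of this Esakia product (so that $\le_d$ is that order), such that $$P:=\Big(\mathbf X(H^*)\textstyle\prod_{\mathsf{Esa}_p}\mathbf X(G^*),\,\tau,\,\mathcal K\Big)\in\mathsf{PHS}_0\qquad\text{and}\qquad \mathbf X(H)\textstyle\prod_{\mathsf{PHS}_0}\mathbf X(G)\cong P\ \text{ in }\mathsf{PHS}_0 .$$ -/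

import Mathlib

open Set TopologicalSpace CategoryTheory CategoryTheory.Limits
open scoped Topology

universe u

namespace PrelinearHilbert

/-! ### Hilbert algebras -/

/-- A Hilbert algebra `(H, ⇨, ⊤)`. Its natural order is `a ≤ b ↔ a ⇨ b = ⊤`. -/
class HilbertAlgebra (H : Type u) extends HImp H, Top H where
  imp_const : ∀ a b : H, a ⇨ (b ⇨ a) = ⊤
  imp_distrib : ∀ a b c : H, (a ⇨ (b ⇨ c)) ⇨ ((a ⇨ b) ⇨ (a ⇨ c)) = ⊤
  imp_antisymm : ∀ a b : H, a ⇨ b = ⊤ → b ⇨ a = ⊤ → a = b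

/-- A bounded Hilbert algebra: `⊥` is the least element of the natural order. -/
class BoundedHilbertAlgebra (H : Type u) extends HilbertAlgebra H, Bot H where
  bot_imp : ∀ a : H, ⊥ ⇨ a = ⊤

/-- Prelinearity, as the equation `((a ⇨ b) ⇨ c) ⇨ (((b ⇨ a) ⇨ c) ⇨ c) = ⊤`, which axiomatizes
the variety generated by the Hilbert chains within Hilbert algebras. -/
class IsPrelinear (H : Type u) [HilbertAlgebra H] : Prop where
  prelinear : ∀ a b c : H, ((a ⇨ b) ⇨ c) ⇨ (((b ⇨ a) ⇨ c) ⇨ c) = ⊤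

/-- Prelinear Heyting algebras (Gödel algebras). -/
class PrelinearHeyting (A : Type u) [HeytingAlgebra A] : Prop where
  himp_sup_himp : ∀ a b : A, (a ⇨ b) ⊔ (b ⇨ a) = ⊤

section Filters

variable {H : Type u} [HilbertAlgebra H]

/-- Implicative filters of a Hilbert algebra. -/
def IsImplicativeFilter (F : Set H) : Prop :=
  ⊤ ∈ F ∧ ∀ a b : H, a ∈ F → a ⇨ b ∈ F → b ∈ F

/-- Irreducible implicative filters: proper, and meet-irreducible among implicative filters. -/
def IsIrreducibleFilter (F : Set H) : Prop :=
  IsImplicativeFilter F ∧ F ≠ univ ∧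
    ∀ F₁ F₂ : Set H, IsImplicativeFilter F₁ → IsImplicativeFilter F₂ →
      F = F₁ ∩ F₂ → F = F₁ ∨ F = F₂

end Filters

/-- The set `X(H)` of irreducible implicative filters, ordered by inclusion. -/
abbrev IrrFilter (H : Type u) [HilbertAlgebra H] : Type u :=
  {F : Set H // IsIrreducibleFilter F}

/-- `φ(a) = {P ∈ X(H) : a ∈ P}`. -/
def phi {H : Type u} [HilbertAlgebra H] (a : H) : Set (IrrFilter H) := {P | a ∈ P.1}

section FilterLemmas

variable {H : Type u} [HilbertAlgebra H]

theorem top_mp {x : H} (h : (⊤ : H) ⇨ x = ⊤) : x = ⊤ := by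
  refine HilbertAlgebra.imp_antisymm x ⊤ ?_ h
  have := HilbertAlgebra.imp_const x (⊤ : H)
  rwa [h] at this

theorem isImplicativeFilter_top : IsImplicativeFilter ({⊤} : Set H) := by
  refine ⟨rfl, ?_⟩
  rintro a b rfl hb
  exact top_mp hb

namespace IsImplicativeFilter

variable {F : Set H}

theorem mp (hF : IsImplicativeFilter F) {a b : H} (hab : a ⇨ b ∈ F) (ha : a ∈ F) : b ∈ F :=
  hF.2 a b ha hab

theorem of_eq_top (hF : IsImplicativeFilter F) {a : H} (h : a = ⊤) : a ∈ F := h ▸ hF.1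

theorem const (hF : IsImplicativeFilter F) {a : H} (b : H) (ha : a ∈ F) : b ⇨ a ∈ F :=
  hF.mp (hF.of_eq_top (HilbertAlgebra.imp_const a b)) ha

theorem dist (hF : IsImplicativeFilter F) {a b c : H} (h : a ⇨ (b ⇨ c) ∈ F) (hb : a ⇨ b ∈ F) :
    a ⇨ c ∈ F :=
  hF.mp (hF.mp (hF.of_eq_top (HilbertAlgebra.imp_distrib a b c)) h) hb

theorem refl (hF : IsImplicativeFilter F) (a : H) : a ⇨ a ∈ F :=
  hF.dist (b := a ⇨ a) (hF.of_eq_top (HilbertAlgebra.imp_const a (a ⇨ a)))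
    (hF.of_eq_top (HilbertAlgebra.imp_const a a))

theorem ext (hF : IsImplicativeFilter F) (a : H) : IsImplicativeFilter {x | a ⇨ x ∈ F} :=
  ⟨hF.const a hF.1, fun _ _ hx hxy => hF.dist hxy hx⟩

/-- Every implicative filter disjoint from a nonempty directed set extends to an irreducible
one that is still disjoint from it. -/
theorem exists_irreducible (hF : IsImplicativeFilter F) {I : Set H} (hne : I.Nonempty)
    (hI : ∀ a ∈ I, ∀ b ∈ I, ∃ c ∈ I, a ⇨ c = ⊤ ∧ b ⇨ c = ⊤) (hd : ∀ a ∈ F, a ∉ I) :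
    ∃ P : IrrFilter H, F ⊆ P.1 ∧ ∀ a ∈ P.1, a ∉ I := by
  obtain ⟨P, hFP, hP⟩ := zorn_subset_nonempty
    {G : Set H | IsImplicativeFilter G ∧ ∀ a ∈ G, a ∉ I} (by
      intro c hc hch ⟨G₀, hG₀⟩
      refine ⟨⋃₀ c, ⟨⟨⟨G₀, hG₀, (hc hG₀).1.1⟩, ?_⟩, ?_⟩, fun s hs => subset_sUnion_of_mem hs⟩
      · rintro a b ⟨G₁, h₁, ha⟩ ⟨G₂, h₂, hab⟩
        rcases hch.total h₁ h₂ with h | h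
        · exact ⟨G₂, h₂, (hc h₂).1.2 a b (h ha) hab⟩
        · exact ⟨G₁, h₁, (hc h₁).1.2 a b ha (h hab)⟩
      · rintro a ⟨G, hG, ha⟩
        exact (hc hG).2 a ha) F ⟨hF, hd⟩
  refine ⟨⟨P, hP.prop.1, ?_, ?_⟩, hFP, hP.prop.2⟩
  · rintro rfl
    obtain ⟨x, hx⟩ := hne
    exact hP.prop.2 x (mem_univ x) hx
  · intro F₁ F₂ h₁ h₂ he
    by_contra! hcon
    have key : ∀ G : Set H, IsImplicativeFilter G → P ⊆ G → P ≠ G → ∃ a ∈ G, a ∈ I := by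
      intro G hG hPG hne
      by_contra! hno
      exact hne (Subset.antisymm hPG (hP.2 ⟨hG, hno⟩ hPG))
    obtain ⟨a, ha, haI⟩ := key F₁ h₁ (he ▸ inter_subset_left) hcon.1
    obtain ⟨b, hb, hbI⟩ := key F₂ h₂ (he ▸ inter_subset_right) hcon.2
    obtain ⟨c, hcI, hac, hbc⟩ := hI a haI b hbI
    refine hP.prop.2 c ?_ hcI
    rw [he]
    exact ⟨h₁.mp (h₁.of_eq_top hac) ha, h₂.mp (h₂.of_eq_top hbc) hb⟩

theorem exists_irreducible_notMem (hF : IsImplicativeFilter F) {a : H} (ha : a ∉ F) :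
    ∃ P : IrrFilter H, F ⊆ P.1 ∧ a ∉ P.1 := by
  obtain ⟨P, h₁, h₂⟩ := hF.exists_irreducible (I := {a}) ⟨a, rfl⟩
    (by
      rintro _ rfl _ rfl
      exact ⟨_, rfl, isImplicativeFilter_top.refl _, isImplicativeFilter_top.refl _⟩)
    (by rintro x hx rfl; exact ha hx)
  exact ⟨P, h₁, fun h => h₂ a h rfl⟩

theorem imp_mem_iff (hF : IsImplicativeFilter F) {a b : H} :
    a ⇨ b ∈ F ↔ ∀ P : IrrFilter H, F ⊆ P.1 → a ∈ P.1 → b ∈ P.1 := by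
  constructor
  · intro h P hP ha
    exact P.2.1.mp (hP h) ha
  · intro h
    by_contra hn
    obtain ⟨P, hP, hb⟩ := (hF.ext a).exists_irreducible_notMem (a := b) hn
    exact hb (h P (fun x hx => hP (hF.const a hx)) (hP (hF.refl a)))

end IsImplicativeFilter

theorem IsIrreducibleFilter.exists_upper {F : Set H} (h : IsIrreducibleFilter F) {a b : H}
    (ha : a ∉ F) (hb : b ∉ F) : ∃ c, c ∉ F ∧ a ⇨ c = ⊤ ∧ b ⇨ c = ⊤ := by
  obtain ⟨hF, -, hirr⟩ := h
  have : ∃ c, c ∉ F ∧ a ⇨ c ∈ F ∧ b ⇨ c ∈ F := by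
    by_contra! hno
    have he : F = {x | a ⇨ x ∈ F} ∩ {x | b ⇨ x ∈ F} := by
      ext x
      refine ⟨fun hx => ⟨hF.const a hx, hF.const b hx⟩, fun hx => ?_⟩
      by_contra hxF
      exact hno x hxF hx.1 hx.2
    rcases hirr _ _ (hF.ext a) (hF.ext b) he with h | h
    · exact ha (h ▸ hF.refl a)
    · exact hb (h ▸ hF.refl b)
  obtain ⟨c, hc, hac, hbc⟩ := this
  have hT := isImplicativeFilter_top (H := H)
  refine ⟨(a ⇨ c) ⇨ ((b ⇨ c) ⇨ c), fun h => hc (hF.mp (hF.mp h hac) hbc), ?_, ?_⟩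
  · have h₁ := hT.ext a
    have h₂ := h₁.ext (a ⇨ c)
    have h₃ := h₂.ext (b ⇨ c)
    exact h₃.mp (a := a) (h₂.const _ (h₁.refl _)) (h₂.const _ (h₁.const _ (hT.refl _)))
  · have h₁ := hT.ext b
    have h₂ := h₁.ext (a ⇨ c)
    have h₃ := h₂.ext (b ⇨ c)
    exact h₃.mp (a := b) (h₂.refl _) (h₂.const _ (h₁.const _ (hT.refl _)))

theorem isIrreducibleFilter_of_exists_upper {F : Set H} (hF : IsImplicativeFilter F)
    (hp : F ≠ univ)
    (h : ∀ a b : H, a ∉ F → b ∉ F → ∃ c, c ∉ F ∧ a ⇨ c = ⊤ ∧ b ⇨ c = ⊤) :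
    IsIrreducibleFilter F := by
  refine ⟨hF, hp, fun F₁ F₂ h₁ h₂ he => ?_⟩
  by_contra! hcon
  have key : ∀ G : Set H, F ⊆ G → F ≠ G → ∃ a ∈ G, a ∉ F := by
    intro G hFG hne
    by_contra! hno
    exact hne (Subset.antisymm hFG hno)
  obtain ⟨a, ha, haF⟩ := key F₁ (he ▸ inter_subset_left) hcon.1
  obtain ⟨b, hb, hbF⟩ := key F₂ (he ▸ inter_subset_right) hcon.2
  obtain ⟨c, hcF, hac, hbc⟩ := h a b haF hbF
  apply hcF
  rw [he]
  exact ⟨h₁.mp (h₁.of_eq_top hac) ha, h₂.mp (h₂.of_eq_top hbc) hb⟩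

/-- The irreducible implicative filters of a prelinear Hilbert algebra form a root system. -/
theorem irrFilter_rootSystem [IsPrelinear H] (P Q Z : IrrFilter H) (hQ : P ≤ Q) (hZ : P ≤ Z) :
    Q ≤ Z ∨ Z ≤ Q := by
  by_contra! hcon
  obtain ⟨a, haQ, haZ⟩ := not_subset.1 hcon.1
  obtain ⟨b, hbZ, hbQ⟩ := not_subset.1 hcon.2
  have h₁ : a ⇨ b ∉ P.1 := fun h => hbQ (Q.2.1.mp (hQ h) haQ)
  have h₂ : b ⇨ a ∉ P.1 := fun h => haZ (Z.2.1.mp (hZ h) hbZ)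
  obtain ⟨c, hc, h₁c, h₂c⟩ := P.2.exists_upper h₁ h₂
  have hl := IsPrelinear.prelinear a b c
  exact hc (P.2.1.mp (P.2.1.mp (P.2.1.of_eq_top hl) (P.2.1.of_eq_top h₁c))
    (P.2.1.of_eq_top h₂c))

end FilterLemmas

/-! ### Hilbert spaces (in the sense of the duality for Hilbert algebras) -/

/-- `(X, τ, K)` is an `H`-space. Here `nhdsKer Y` is the saturation of `Y`, the intersection of
all open sets that contain `Y`, and sobriety (with unique generic points) is
`T0Space` plus `QuasiSober`. -/
structure IsHSpace {X : Type u} (τ : TopologicalSpace X) (K : Set (Set X)) : Prop where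
  isBasis : IsTopologicalBasis K
  isCompact : ∀ U ∈ K, IsCompact U
  sat_mem : ∀ U ∈ K, ∀ V ∈ K, nhdsKer (U ∩ Vᶜ) ∈ K
  t0 : T0Space X
  quasiSober : QuasiSober X

/-- The conditions for `(X, τ, K)` to be an object of `PHSz`: an `H`-space with `X ∈ K` which is a
root system for the order `x ≤_d y ↔ y ∈ closure {x}` (dual of the specialization order). -/
structure IsPHSz {X : Type u} (τ : TopologicalSpace X) (K : Set (Set X)) : Prop
    extends IsHSpace τ K where
  rootSystem : ∀ x y z : X, y ∈ closure {x} → z ∈ closure {x} → z ∈ closure {y} ∨ y ∈ closure {z}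
  univ_mem : univ ∈ K

/-- Objects of `PHSz`. -/
structure PHSz : Type (u + 1) where
  carrier : Type u
  top : TopologicalSpace carrier
  base : Set (Set carrier)
  isPHSz : IsPHSz top base

instance : CoeSort PHSz.{u} (Type u) := ⟨PHSz.carrier⟩

instance (X : PHSz.{u}) : TopologicalSpace X := X.top

/-- `H`-functional relations. -/
structure IsHFunctional {X Y : Type u} [TopologicalSpace X] [TopologicalSpace Y]
    (K : Set (Set X)) (L : Set (Set Y)) (R : X → Y → Prop) : Prop where
  preimage_mem : ∀ U ∈ L, {x | ∃ y ∈ U, R x y} ∈ K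
  isClosed : ∀ x, IsClosed {y | R x y}
  functional : ∀ x y, R x y → ∃ z ∈ closure {x}, {w | R z w} = closure {y}

/-- Morphisms of `PHSz`: `H`-functional relations `R` with `R(x) ≠ ∅` for every `x`. -/
@[ext]
structure PHSzHom (X Y : PHSz.{u}) : Type u where
  rel : X → Y → Prop
  isHFunctional : IsHFunctional X.base Y.base rel
  nonempty : ∀ x, ∃ y, rel x y

namespace PHSzHom

variable {X Y Z : PHSz.{u}}

theorem anti (R : PHSzHom X Y) {x x' : X} (h : x' ∈ closure {x}) {y : Y} (hy : R.rel x' y) :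
    R.rel x y := by
  by_contra hn
  obtain ⟨U, hU, hyU, hUs⟩ := Y.isPHSz.isBasis.exists_subset_of_mem_open
    (show y ∈ {y | R.rel x y}ᶜ from hn) (R.isHFunctional.isClosed x).isOpen_compl
  have hop := X.isPHSz.isBasis.isOpen (R.isHFunctional.preimage_mem U hU)
  obtain ⟨w, ⟨v, hv, hwv⟩, rfl⟩ := mem_closure_iff.1 h _ hop ⟨y, hyU, hy⟩
  exact hUs hv hwv

theorem up (R : PHSzHom X Y) {x : X} {y y' : Y} (hy : R.rel x y) (h : y' ∈ closure {y}) :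
    R.rel x y' :=
  closure_minimal (singleton_subset_iff.2 hy) (R.isHFunctional.isClosed x) h

/-- In `PHSz` every `R(x)` is the closure of a point. -/
theorem exists_eq_closure (R : PHSzHom X Y) (x : X) :
    ∃ y, {w | R.rel x w} = closure {y} := by
  have hchain : ∀ y₁ y₂, R.rel x y₁ → R.rel x y₂ → y₁ ∈ closure {y₂} ∨ y₂ ∈ closure {y₁} := by
    intro y₁ y₂ h₁ h₂
    obtain ⟨z₁, hz₁, e₁⟩ := R.isHFunctional.functional x y₁ h₁
    obtain ⟨z₂, hz₂, e₂⟩ := R.isHFunctional.functional x y₂ h₂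
    have m₁ : R.rel z₁ y₁ := by
      change y₁ ∈ {w | R.rel z₁ w}
      rw [e₁]; exact subset_closure rfl
    have m₂ : R.rel z₂ y₂ := by
      change y₂ ∈ {w | R.rel z₂ w}
      rw [e₂]; exact subset_closure rfl
    rcases X.isPHSz.rootSystem x z₁ z₂ hz₁ hz₂ with h | h
    · right; rw [← e₁]; exact R.anti h m₂
    · left; rw [← e₂]; exact R.anti h m₁
  have hirr : IsIrreducible {w | R.rel x w} := by
    refine ⟨R.nonempty x, ?_⟩
    rintro u v hu hv ⟨y₁, h₁, hy₁⟩ ⟨y₂, h₂, hy₂⟩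
    rcases hchain y₁ y₂ h₁ h₂ with h | h
    · obtain ⟨w, hw, rfl⟩ := mem_closure_iff.1 h u hu hy₁
      exact ⟨w, h₂, hw, hy₂⟩
    · obtain ⟨w, hw, rfl⟩ := mem_closure_iff.1 h v hv hy₂
      exact ⟨w, h₁, hy₁, hw⟩
  obtain ⟨y, hy⟩ := Y.isPHSz.quasiSober.sober hirr (R.isHFunctional.isClosed x)
  exact ⟨y, hy.symm⟩

/-- The identity morphism is the relation `≤_d`. -/
def id (X : PHSz.{u}) : PHSzHom X X where
  rel x y := y ∈ closure {x}
  isHFunctional :=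
    { preimage_mem := by
        intro U hU
        have : {x : X | ∃ y ∈ U, y ∈ closure {x}} = U := by
          ext x
          constructor
          · rintro ⟨y, hyU, hy⟩
            obtain ⟨w, hw, rfl⟩ := mem_closure_iff.1 hy U (X.isPHSz.isBasis.isOpen hU) hyU
            exact hw
          · exact fun hx => ⟨x, hx, subset_closure rfl⟩
        rwa [this]
      isClosed := fun _ => isClosed_closure
      functional := fun _ y hy => ⟨y, hy, rfl⟩ }
  nonempty x := ⟨x, subset_closure rfl⟩

/-- Composition of morphisms is composition of relations. -/
def comp (R : PHSzHom X Y) (S : PHSzHom Y Z) : PHSzHom X Z where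
  rel x z := ∃ y, R.rel x y ∧ S.rel y z
  isHFunctional :=
    { preimage_mem := by
        intro U hU
        have h := R.isHFunctional.preimage_mem _ (S.isHFunctional.preimage_mem U hU)
        convert h using 1
        ext x
        constructor
        · rintro ⟨z, hz, y, hxy, hyz⟩
          exact ⟨y, ⟨z, hz, hyz⟩, hxy⟩
        · rintro ⟨y, ⟨z, hz, hyz⟩, hxy⟩
          exact ⟨z, hz, y, hxy, hyz⟩
      isClosed := by
        intro x
        obtain ⟨y, hy⟩ := R.exists_eq_closure x
        have : {z | ∃ y, R.rel x y ∧ S.rel y z} = {z | S.rel y z} := by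
          ext z
          constructor
          · rintro ⟨y', hxy', hz⟩
            have h' : y' ∈ {w | R.rel x w} := hxy'
            rw [hy] at h'
            exact S.anti h' hz
          · intro hz
            refine ⟨y, ?_, hz⟩
            change y ∈ {w | R.rel x w}
            rw [hy]; exact subset_closure rfl
        rw [this]
        exact S.isHFunctional.isClosed y
      functional := by
        rintro x z ⟨y, hxy, hyz⟩
        obtain ⟨y', hy', e'⟩ := S.isHFunctional.functional y z hyz
        obtain ⟨x', hx', e''⟩ := R.isHFunctional.functional x y' (R.up hxy hy')
        refine ⟨x', hx', ?_⟩
        rw [← e']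
        ext w
        constructor
        · rintro ⟨v, hv, hw⟩
          have h' : v ∈ {w | R.rel x' w} := hv
          rw [e''] at h'
          exact S.anti h' hw
        · intro hw
          refine ⟨y', ?_, hw⟩
          change y' ∈ {w | R.rel x' w}
          rw [e'']; exact subset_closure rfl }
  nonempty x := by
    obtain ⟨y, hy⟩ := R.nonempty x
    obtain ⟨z, hz⟩ := S.nonempty y
    exact ⟨z, y, hy, hz⟩

end PHSzHom

instance : Category PHSz.{u} where
  Hom := PHSzHom
  id := PHSzHom.id
  comp := PHSzHom.comp
  id_comp R := by
    apply PHSzHom.ext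
    funext x y
    apply propext
    constructor
    · rintro ⟨x', hx', h⟩
      exact R.anti hx' h
    · exact fun h => ⟨x, subset_closure rfl, h⟩
  comp_id R := by
    apply PHSzHom.ext
    funext x y
    apply propext
    constructor
    · rintro ⟨y', h, hy'⟩
      exact R.up h hy'
    · exact fun h => ⟨y, h, subset_closure rfl⟩
  assoc R S T := by
    apply PHSzHom.ext
    funext x w
    apply propext
    constructor
    · rintro ⟨z, ⟨y, h₁, h₂⟩, h₃⟩
      exact ⟨y, h₁, z, h₂, h₃⟩
    · rintro ⟨y, h₁, z, h₂, h₃⟩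
      exact ⟨z, ⟨y, h₁, h₂⟩, h₃⟩

/-! ### The `H`-space of a Hilbert algebra -/

section HSpaceOfHilbert

variable (H : Type u) [HilbertAlgebra H]

/-- The family `K_H = {φ(a)ᶜ : a ∈ H}`. -/
def kBase : Set (Set (IrrFilter H)) := {U | ∃ a : H, U = (phi a)ᶜ}

/-- The topology on `X(H)` with base `K_H`. -/
@[reducible] def hTopology : TopologicalSpace (IrrFilter H) := generateFrom (kBase H)

theorem kBase_isBasis [Nonempty H] :
    @IsTopologicalBasis _ (hTopology H) (kBase H) := by
  let _ := hTopology H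
  refine ⟨?_, ?_, rfl⟩
  · rintro _ ⟨a, rfl⟩ _ ⟨b, rfl⟩ P ⟨ha, hb⟩
    obtain ⟨c, hc, hac, hbc⟩ := P.2.exists_upper ha hb
    refine ⟨_, ⟨c, rfl⟩, hc, fun Q hQ => ⟨fun h => hQ ?_, fun h => hQ ?_⟩⟩
    · exact Q.2.1.mp (Q.2.1.of_eq_top hac) h
    · exact Q.2.1.mp (Q.2.1.of_eq_top hbc) h
  · refine eq_univ_of_forall fun P => ?_
    obtain ⟨a, ha⟩ := (ne_univ_iff_exists_notMem _).1 P.2.2.1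
    exact ⟨_, ⟨a, rfl⟩, ha⟩

variable {H}

theorem mem_closure_singleton_iff (P Q : IrrFilter H) :
    Q ∈ @closure _ (hTopology H) {P} ↔ P ≤ Q := by
  let _ := hTopology H
  have : Nonempty H := ⟨⊤⟩
  rw [(kBase_isBasis H).mem_closure_iff]
  constructor
  · intro h a ha
    by_contra haQ
    obtain ⟨_, h₁, rfl⟩ := h _ ⟨a, rfl⟩ haQ
    exact h₁ ha
  · rintro h _ ⟨a, rfl⟩ haQ
    exact ⟨P, fun ha => haQ (h ha), rfl⟩

theorem mem_nhdsKer_iff (Y : Set (IrrFilter H)) (P : IrrFilter H) :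
    P ∈ @nhdsKer _ (hTopology H) Y ↔ ∃ Q ∈ Y, P ≤ Q := by
  let _ := hTopology H
  rw [mem_nhdsKer_iff_specializes]
  simp only [specializes_iff_mem_closure, mem_closure_singleton_iff]

theorem isHSpace_kBase : IsHSpace (hTopology H) (kBase H) := by
  let _ := hTopology H
  have : Nonempty H := ⟨⊤⟩
  refine ⟨kBase_isBasis H, ?_, ?_, ?_, ?_⟩
  · rintro _ ⟨a, rfl⟩
    refine isCompact_generateFrom rfl fun C hC hcov => ?_
    let S : Set H := {b | (phi b)ᶜ ∈ C}
    let F : Set H := {x | ∃ T : Set H, T.Finite ∧ T ⊆ S ∧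
      ∀ P : IrrFilter H, T ⊆ P.1 → x ∈ P.1}
    have hF : IsImplicativeFilter F := by
      refine ⟨⟨∅, finite_empty, empty_subset _, fun P _ => P.2.1.1⟩, ?_⟩
      rintro x y ⟨T, hT, hTS, h⟩ ⟨T', hT', hTS', h'⟩
      refine ⟨T ∪ T', hT.union hT', union_subset hTS hTS', fun P hP => ?_⟩
      exact P.2.1.mp (h' P (subset_union_right.trans hP)) (h P (subset_union_left.trans hP))
    have haF : a ∈ F := by
      by_contra hn
      obtain ⟨P, hFP, haP⟩ := hF.exists_irreducible_notMem hn
      obtain ⟨U, hUC, hPU⟩ := hcov (show P ∈ (phi a)ᶜ from haP)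
      obtain ⟨b, rfl⟩ := hC hUC
      refine hPU (hFP ⟨{b}, finite_singleton b, singleton_subset_iff.2 hUC, fun Q hQ => ?_⟩)
      exact hQ rfl
    obtain ⟨T, hT, hTS, h⟩ := haF
    refine ⟨(fun b => (phi b)ᶜ) '' T, ?_, hT.image _, ?_⟩
    · rintro _ ⟨b, hb, rfl⟩
      exact hTS hb
    · intro P hP
      by_contra hn
      refine hP (h P fun b hb => ?_)
      by_contra hbP
      exact hn ⟨_, ⟨b, hb, rfl⟩, hbP⟩
  · rintro _ ⟨a, rfl⟩ _ ⟨b, rfl⟩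
    refine ⟨b ⇨ a, ?_⟩
    ext P
    rw [mem_nhdsKer_iff]
    have := P.2.1.imp_mem_iff (a := b) (b := a)
    change _ ↔ ¬ (b ⇨ a ∈ P.1)
    rw [this]
    push Not
    constructor
    · rintro ⟨Q, ⟨ha, hb⟩, hPQ⟩
      exact ⟨Q, hPQ, not_not.1 hb, ha⟩
    · rintro ⟨Q, hPQ, hb, ha⟩
      exact ⟨Q, ⟨ha, not_not.2 hb⟩, hPQ⟩
  · refine ⟨fun P Q h => ?_⟩
    rw [inseparable_iff_mem_closure, mem_closure_singleton_iff, mem_closure_singleton_iff] at h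
    exact le_antisymm h.2 h.1
  · refine ⟨fun {Y} hY hYc => ?_⟩
    let F : Set H := {a | ∀ P ∈ Y, a ∈ P.1}
    have hF : IsImplicativeFilter F :=
      ⟨fun P _ => P.2.1.1, fun a b ha hab P hP => P.2.1.mp (hab P hP) (ha P hP)⟩
    have hop : ∀ a : H, IsOpen (phi a)ᶜ := fun a => (kBase_isBasis H).isOpen ⟨a, rfl⟩
    have hirr : IsIrreducibleFilter F := by
      refine isIrreducibleFilter_of_exists_upper hF ?_ ?_
      · obtain ⟨P, hP⟩ := hY.1
        intro h
        refine P.2.2.1 (eq_univ_of_forall fun a => ?_)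
        have ha : a ∈ F := h ▸ mem_univ a
        exact ha P hP
      · intro a b ha hb
        have ha' : ∃ P ∈ Y, a ∉ P.1 := by
          by_contra! hn
          exact ha hn
        have hb' : ∃ P ∈ Y, b ∉ P.1 := by
          by_contra! hn
          exact hb hn
        obtain ⟨P, hP, haP⟩ := ha'
        obtain ⟨Q, hQ, hbQ⟩ := hb'
        obtain ⟨Z, hZ, haZ, hbZ⟩ := hY.2 _ _ (hop a) (hop b) ⟨P, hP, haP⟩ ⟨Q, hQ, hbQ⟩
        obtain ⟨c, hc, hac, hbc⟩ := Z.2.exists_upper haZ hbZ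
        exact ⟨c, fun h => hc (h Z hZ), hac, hbc⟩
    refine ⟨⟨F, hirr⟩, ?_⟩
    change closure _ = Y
    ext Q
    rw [mem_closure_singleton_iff]
    constructor
    · intro hFQ
      by_contra hQ
      obtain ⟨_, ⟨a, rfl⟩, haQ, hsub⟩ := (kBase_isBasis H).exists_subset_of_mem_open
        (show Q ∈ Yᶜ from hQ) hYc.isOpen_compl
      refine haQ (hFQ fun P hP => ?_)
      by_contra haP
      exact hsub haP hP
    · exact fun hQ a ha => ha Q hQ

end HSpaceOfHilbert

theorem isPHSz_kBase (H : Type u) [BoundedHilbertAlgebra H] [IsPrelinear H] :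
    IsPHSz (hTopology H) (kBase H) := by
  let _ := hTopology H
  refine { isHSpace_kBase with rootSystem := ?_, univ_mem := ⟨⊥, ?_⟩ }
  · intro P Q Z hQ hZ
    rw [mem_closure_singleton_iff] at *
    rw [mem_closure_singleton_iff]
    exact irrFilter_rootSystem P Q Z hQ hZ
  · refine (eq_univ_of_forall fun P hP => P.2.2.1 (eq_univ_of_forall fun a => ?_)).symm
    exact P.2.1.mp (P.2.1.of_eq_top (BoundedHilbertAlgebra.bot_imp a)) hP

/-- The object `X(H) = (X(H), K_H)` of `PHSz` associated with a bounded prelinear Hilbert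
algebra `H`. -/
def PHSz.ofHilbert (H : Type u) [BoundedHilbertAlgebra H] [IsPrelinear H] : PHSz.{u} where
  carrier := IrrFilter H
  top := hTopology H
  base := kBase H
  isPHSz := isPHSz_kBase H

/-! ### Heyting algebras and the algebra `H*` -/

/-- The bounded Hilbert algebra reduct of a Heyting algebra. -/
instance HeytingAlgebra.toBoundedHilbert (A : Type u) [HeytingAlgebra A] :
    BoundedHilbertAlgebra A where
  imp_const a b := by simp
  imp_distrib a b c := by
    rw [himp_eq_top_iff, le_himp_iff, le_himp_iff]
    have h₁ : (a ⇨ b ⇨ c) ⊓ (a ⇨ b) ⊓ a ≤ b := by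
      calc _ ≤ (a ⇨ b) ⊓ a := by gcongr; exact inf_le_right
        _ ≤ b := himp_inf_le
    have h₂ : (a ⇨ b ⇨ c) ⊓ (a ⇨ b) ⊓ a ≤ b ⇨ c := by
      calc _ ≤ (a ⇨ b ⇨ c) ⊓ a := by gcongr; exact inf_le_left
        _ ≤ b ⇨ c := himp_inf_le
    exact (le_inf h₂ h₁).trans himp_inf_le
  imp_antisymm a b h₁ h₂ := le_antisymm (himp_eq_top_iff.1 h₁) (himp_eq_top_iff.1 h₂)
  bot_imp a := by simp

instance PrelinearHeyting.isPrelinear (A : Type u) [HeytingAlgebra A] [PrelinearHeyting A] :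
    IsPrelinear A where
  prelinear a b c := by
    rw [himp_eq_top_iff, le_himp_iff, ← sup_himp_distrib, PrelinearHeyting.himp_sup_himp, top_himp]

section HeytingFilters

variable {A : Type u} [HeytingAlgebra A]

theorem irr_mono (P : IrrFilter A) {a b : A} (h : a ≤ b) (ha : a ∈ P.1) : b ∈ P.1 :=
  P.2.1.mp (P.2.1.of_eq_top (himp_eq_top_iff.2 h)) ha

theorem irr_inf (P : IrrFilter A) {a b : A} : a ⊓ b ∈ P.1 ↔ a ∈ P.1 ∧ b ∈ P.1 := by
  refine ⟨fun h => ⟨irr_mono P inf_le_left h, irr_mono P inf_le_right h⟩, fun ⟨ha, hb⟩ => ?_⟩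
  refine P.2.1.mp (a := b) ?_ hb
  exact irr_mono P (le_himp_iff.2 le_rfl) ha

theorem irr_sup (P : IrrFilter A) {a b : A} : a ⊔ b ∈ P.1 ↔ a ∈ P.1 ∨ b ∈ P.1 := by
  refine ⟨fun h => ?_, fun h => h.elim (irr_mono P le_sup_left) (irr_mono P le_sup_right)⟩
  by_contra! hn
  obtain ⟨c, hc, hac, hbc⟩ := P.2.exists_upper hn.1 hn.2
  exact hc (irr_mono P (sup_le (himp_eq_top_iff.1 hac) (himp_eq_top_iff.1 hbc)) h)

theorem irr_bot (P : IrrFilter A) : (⊥ : A) ∉ P.1 := fun h =>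
  P.2.2.1 (eq_univ_of_forall fun _ => irr_mono P bot_le h)

/-- In a Heyting algebra the irreducible implicative filters are exactly the prime filters. -/
theorem isIrreducibleFilter_iff_prime (F : Set A) :
    IsIrreducibleFilter F ↔
      (⊤ ∈ F ∧ (∀ a b, a ≤ b → a ∈ F → b ∈ F) ∧ (∀ a b, a ∈ F → b ∈ F → a ⊓ b ∈ F)) ∧
        ⊥ ∉ F ∧ ∀ a b, a ⊔ b ∈ F → a ∈ F ∨ b ∈ F := by
  constructor
  · intro h
    let P : IrrFilter A := ⟨F, h⟩
    exact ⟨⟨h.1.1, fun a b => irr_mono P, fun a b ha hb => (irr_inf P).2 ⟨ha, hb⟩⟩, irr_bot P,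
      fun a b => (irr_sup P).1⟩
  · rintro ⟨⟨h₁, h₂, h₃⟩, h₄, h₅⟩
    refine isIrreducibleFilter_of_exists_upper ⟨h₁, fun a b ha hab => ?_⟩ ?_ ?_
    · exact h₂ _ _ himp_inf_le (h₃ _ _ hab ha)
    · rintro rfl
      exact h₄ (mem_univ _)
    · intro a b ha hb
      exact ⟨a ⊔ b, fun h => (h₅ a b h).elim ha hb, by simp, by simp⟩

end HeytingFilters

section Hstar

variable (H : Type u) [HilbertAlgebra H]

/-- Membership in the Heyting subalgebra generated by `φ(H)` in the Heyting algebra of upsets of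
`X(H)`, whose operations are `∩`, `∪`, `∅`, `X(H)` and `U ⇒ V = (U ∩ Vᶜ]ᶜ`. -/
inductive InHstar : Set (IrrFilter H) → Prop
  | basic (a : H) : InHstar (phi a)
  | empty : InHstar ∅
  | univ : InHstar univ
  | inter {U V : Set (IrrFilter H)} : InHstar U → InHstar V → InHstar (U ∩ V)
  | union {U V : Set (IrrFilter H)} : InHstar U → InHstar V → InHstar (U ∪ V)
  | imp {U V : Set (IrrFilter H)} : InHstar U → InHstar V →
      InHstar ((lowerClosure (U ∩ Vᶜ) : Set (IrrFilter H))ᶜ)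

/-- The Heyting algebra `H*`. -/
def Hstar : Type u := {U : Set (IrrFilter H) // InHstar H U}

variable {H}

theorem InHstar.isUpperSet {U : Set (IrrFilter H)} (h : InHstar H U) : IsUpperSet U := by
  induction h with
  | basic a => exact fun P Q hPQ ha => hPQ ha
  | empty => exact isUpperSet_empty
  | univ => exact isUpperSet_univ
  | inter _ _ h₁ h₂ => exact h₁.inter h₂
  | union _ _ h₁ h₂ => exact h₁.union h₂
  | imp _ _ _ _ => exact (lowerClosure _).lower.compl

instance : PartialOrder (Hstar H) := inferInstanceAs (PartialOrder {U // InHstar H U})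

instance : HeytingAlgebra (Hstar H) where
  sup U V := ⟨U.1 ∪ V.1, .union U.2 V.2⟩
  inf U V := ⟨U.1 ∩ V.1, .inter U.2 V.2⟩
  top := ⟨univ, .univ⟩
  bot := ⟨∅, .empty⟩
  himp U V := ⟨_, .imp U.2 V.2⟩
  compl U := ⟨_, .imp U.2 .empty⟩
  le_sup_left U V := show U.1 ⊆ U.1 ∪ V.1 from subset_union_left
  le_sup_right U V := show V.1 ⊆ U.1 ∪ V.1 from subset_union_right
  sup_le U V W h₁ h₂ := show U.1 ∪ V.1 ⊆ W.1 from union_subset h₁ h₂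
  inf_le_left U V := show U.1 ∩ V.1 ⊆ U.1 from inter_subset_left
  inf_le_right U V := show U.1 ∩ V.1 ⊆ V.1 from inter_subset_right
  le_inf U V W h₁ h₂ := show U.1 ⊆ V.1 ∩ W.1 from subset_inter h₁ h₂
  le_top U := show U.1 ⊆ univ from subset_univ _
  bot_le U := show ∅ ⊆ U.1 from empty_subset _
  le_himp_iff U V W := by
    change U.1 ⊆ (lowerClosure (V.1 ∩ W.1ᶜ) : Set (IrrFilter H))ᶜ ↔ U.1 ∩ V.1 ⊆ W.1
    constructor
    · rintro h P ⟨hU, hV⟩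
      by_contra hW
      exact h hU (subset_lowerClosure ⟨hV, hW⟩)
    · rintro h P hU ⟨Q, ⟨hV, hW⟩, hPQ⟩
      exact hW (h ⟨U.2.isUpperSet hPQ hU, hV⟩)
  himp_bot U := rfl

instance [IsPrelinear H] : PrelinearHeyting (Hstar H) where
  himp_sup_himp U V := by
    apply Subtype.ext
    refine eq_univ_of_forall fun P => ?_
    change P ∈ (lowerClosure (U.1 ∩ V.1ᶜ) : Set (IrrFilter H))ᶜ ∪
      (lowerClosure (V.1 ∩ U.1ᶜ) : Set (IrrFilter H))ᶜ
    by_contra hn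
    rw [mem_union, not_or, notMem_compl_iff, notMem_compl_iff] at hn
    obtain ⟨⟨Q, ⟨hQU, hQV⟩, hPQ⟩, ⟨Z, ⟨hZV, hZU⟩, hPZ⟩⟩ := hn
    rcases irrFilter_rootSystem P Q Z hPQ hPZ with h | h
    · exact hZU (U.2.isUpperSet h hQU)
    · exact hQV (V.2.isUpperSet h hZV)

end Hstar

/-! ### Esakia spaces that are root systems -/

/-- Objects of the category of Esakia spaces whose underlying poset is a root system. An Esakia
space is a compact Priestley space in which the downset of a clopen set is clopen. -/
structure Esap : Type (u + 1) where
  carrier : Type u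
  [order : PartialOrder carrier]
  [top : TopologicalSpace carrier]
  [compact : CompactSpace carrier]
  [priestley : PriestleySpace carrier]
  isClopen_lowerClosure : ∀ U : Set carrier, IsClopen U →
    IsClopen (lowerClosure U : Set carrier)
  rootSystem : ∀ x y z : carrier, x ≤ y → x ≤ z → y ≤ z ∨ z ≤ y

instance : CoeSort Esap.{u} (Type u) := ⟨Esap.carrier⟩

attribute [instance] Esap.order Esap.top Esap.compact Esap.priestley

/-- Morphisms are the continuous p-morphisms. -/
instance : Category Esap.{u} where
  Hom X Y := EsakiaHom X Y
  id X := EsakiaHom.id X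
  comp f g := EsakiaHom.comp g f
  id_comp _ := EsakiaHom.comp_id _
  comp_id _ := EsakiaHom.id_comp _
  assoc _ _ _ := rfl

section EsakiaDual

variable (A : Type u) [HeytingAlgebra A]

/-- The topology of the Esakia dual of `A`, generated by the sets `φ(a)` and `φ(a)ᶜ`. -/
@[reducible] def esakiaTopology : TopologicalSpace (IrrFilter A) :=
  generateFrom ({U | ∃ a : A, U = phi a} ∪ {U | ∃ a : A, U = (phi a)ᶜ})

variable {A}

theorem isClopen_phi (a : A) : @IsClopen _ (esakiaTopology A) (phi a) := by
  let _ := esakiaTopology A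
  exact ⟨⟨isOpen_generateFrom_of_mem (Or.inr ⟨a, rfl⟩)⟩,
    isOpen_generateFrom_of_mem (Or.inl ⟨a, rfl⟩)⟩

theorem esakia_isBasis :
    @IsTopologicalBasis _ (esakiaTopology A) (range fun p : A × A => phi p.1 ∩ (phi p.2)ᶜ) := by
  let _ := esakiaTopology A
  refine ⟨?_, ?_, ?_⟩
  · rintro _ ⟨⟨a, b⟩, rfl⟩ _ ⟨⟨a', b'⟩, rfl⟩ P ⟨⟨ha, hb⟩, ⟨ha', hb'⟩⟩
    refine ⟨_, ⟨⟨a ⊓ a', b ⊔ b'⟩, rfl⟩, ⟨(irr_inf P).2 ⟨ha, ha'⟩, fun h => ?_⟩, ?_⟩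
    · exact ((irr_sup P).1 h).elim hb hb'
    · rintro Q ⟨h₁, h₂⟩
      have h₁' := (irr_inf Q).1 h₁
      exact ⟨⟨h₁'.1, fun h => h₂ ((irr_sup Q).2 (Or.inl h))⟩,
        ⟨h₁'.2, fun h => h₂ ((irr_sup Q).2 (Or.inr h))⟩⟩
  · refine eq_univ_of_forall fun P => ?_
    exact ⟨_, ⟨⟨⊤, ⊥⟩, rfl⟩, P.2.1.1, irr_bot P⟩
  · apply le_antisymm
    · refine le_generateFrom ?_
      rintro _ ⟨⟨a, b⟩, rfl⟩
      exact (isClopen_phi a).isOpen.inter (isClopen_phi b).compl.isOpen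
    · refine le_generateFrom ?_
      rintro _ (⟨a, rfl⟩ | ⟨a, rfl⟩)
      · refine isOpen_generateFrom_of_mem ⟨⟨a, ⊥⟩, ?_⟩
        ext P
        exact ⟨fun h => h.1, fun h => ⟨h, irr_bot P⟩⟩
      · refine isOpen_generateFrom_of_mem ⟨⟨⊤, a⟩, ?_⟩
        ext P
        exact ⟨fun h => h.2, fun h => ⟨P.2.1.1, h⟩⟩

theorem esakia_compactSpace : @CompactSpace _ (esakiaTopology A) := by
  let _ := esakiaTopology A
  refine ⟨isCompact_generateFrom rfl fun C hC hcov => ?_⟩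
  by_contra hno
  have hno' : ∀ T S : Set A, T.Finite → S.Finite → (∀ b ∈ T, (phi b)ᶜ ∈ C) →
      (∀ a ∈ S, phi a ∈ C) → ∃ P : IrrFilter A, T ⊆ P.1 ∧ ∀ a ∈ S, a ∉ P.1 := by
    intro T S hT hS hTC hSC
    by_contra! hP
    refine hno ⟨(fun b => (phi b)ᶜ) '' T ∪ phi '' S, ?_, (hT.image _).union (hS.image _), ?_⟩
    · rintro _ (⟨b, hb, rfl⟩ | ⟨a, ha, rfl⟩)
      · exact hTC b hb
      · exact hSC a ha
    · intro P _
      by_cases hTP : T ⊆ P.1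
      · obtain ⟨a, ha, haP⟩ := hP P hTP
        exact ⟨_, Or.inr ⟨a, ha, rfl⟩, haP⟩
      · obtain ⟨b, hb, hbP⟩ := not_subset.1 hTP
        exact ⟨_, Or.inl ⟨b, hb, rfl⟩, hbP⟩
  let F : Set A := {x | ∃ T : Set A, T.Finite ∧ (∀ b ∈ T, (phi b)ᶜ ∈ C) ∧
    ∀ P : IrrFilter A, T ⊆ P.1 → x ∈ P.1}
  let I : Set A := {x | ∃ S : Set A, S.Finite ∧ (∀ a ∈ S, phi a ∈ C) ∧
    ∀ P : IrrFilter A, x ∈ P.1 → ∃ a ∈ S, a ∈ P.1}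
  have hF : IsImplicativeFilter F := by
    refine ⟨⟨∅, finite_empty, by simp, fun P _ => P.2.1.1⟩, ?_⟩
    rintro x y ⟨T, hT, hTS, h⟩ ⟨T', hT', hTS', h'⟩
    refine ⟨T ∪ T', hT.union hT', ?_, fun P hP => ?_⟩
    · rintro b (hb | hb)
      · exact hTS b hb
      · exact hTS' b hb
    · exact P.2.1.mp (h' P (subset_union_right.trans hP)) (h P (subset_union_left.trans hP))
  obtain ⟨P, hFP, hIP⟩ := hF.exists_irreducible (I := I)
    ⟨⊥, ∅, finite_empty, by simp, fun P h => (irr_bot P h).elim⟩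
    (by
      rintro x ⟨S, hS, hSC, h⟩ y ⟨S', hS', hSC', h'⟩
      refine ⟨x ⊔ y, ⟨S ∪ S', hS.union hS', ?_, fun P hP => ?_⟩, by simp, by simp⟩
      · rintro b (hb | hb)
        · exact hSC b hb
        · exact hSC' b hb
      · rcases (irr_sup P).1 hP with hx | hy
        · obtain ⟨a, ha, haP⟩ := h P hx
          exact ⟨a, Or.inl ha, haP⟩
        · obtain ⟨a, ha, haP⟩ := h' P hy
          exact ⟨a, Or.inr ha, haP⟩)
    (by
      rintro x ⟨T, hT, hTC, h⟩ ⟨S, hS, hSC, h'⟩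
      obtain ⟨P, hTP, hSP⟩ := hno' T S hT hS hTC hSC
      obtain ⟨a, ha, haP⟩ := h' P (h P hTP)
      exact hSP a ha haP)
  obtain ⟨U, hUC, hPU⟩ := hcov (mem_univ P)
  rcases hC hUC with ⟨a, rfl⟩ | ⟨b, rfl⟩
  · exact hIP a hPU ⟨{a}, finite_singleton a, by simpa using hUC, fun Q hQ => ⟨a, rfl, hQ⟩⟩
  · exact hPU (hFP ⟨{b}, finite_singleton b, by simpa using hUC, fun Q hQ => hQ rfl⟩)

theorem esakia_priestley : @PriestleySpace _ _ (esakiaTopology A) := by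
  let _ := esakiaTopology A
  refine ⟨fun {P Q} h => ?_⟩
  obtain ⟨a, haP, haQ⟩ := not_subset.1 h
  exact ⟨phi a, isClopen_phi a, fun _ _ h ha => h ha, haP, haQ⟩

theorem lowerClosure_phi (a b : A) :
    (lowerClosure (phi a ∩ (phi b)ᶜ) : Set (IrrFilter A)) = (phi (a ⇨ b))ᶜ := by
  ext P
  have := P.2.1.imp_mem_iff (a := a) (b := b)
  change _ ↔ ¬ (a ⇨ b ∈ P.1)
  rw [this]
  push Not
  constructor
  · rintro ⟨Q, ⟨ha, hb⟩, hPQ⟩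
    exact ⟨Q, hPQ, ha, hb⟩
  · rintro ⟨Q, hPQ, ha, hb⟩
    exact ⟨Q, ⟨ha, hb⟩, hPQ⟩

theorem esakia_isClopen_lowerClosure (U : Set (IrrFilter A))
    (hU : @IsClopen _ (esakiaTopology A) U) :
    @IsClopen _ (esakiaTopology A) (lowerClosure U : Set (IrrFilter A)) := by
  let _ := esakiaTopology A
  have := esakia_compactSpace (A := A)
  obtain ⟨s, hs, rfl⟩ := eq_finite_iUnion_of_isTopologicalBasis_of_isCompact_open
    (fun p : A × A => phi p.1 ∩ (phi p.2)ᶜ) esakia_isBasis U hU.isClosed.isCompact hU.isOpen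
  simp only [lowerClosure_iUnion, LowerSet.coe_iSup, lowerClosure_phi]
  exact hs.isClopen_biUnion fun p _ => (isClopen_phi _).compl

end EsakiaDual

/-- The Esakia space `X(A)` of a prelinear Heyting algebra `A`: the prime filters of `A` (that is,
its irreducible implicative filters) ordered by inclusion, with the topology generated by the
sets `φ(a)` and their complements. -/
def Esap.ofHeyting (A : Type u) [HeytingAlgebra A] [PrelinearHeyting A] : Esap.{u} :=
  letI := esakiaTopology A
  haveI := esakia_compactSpace (A := A)
  haveI := esakia_priestley (A := A)
  { carrier := IrrFilter A
    isClopen_lowerClosure := esakia_isClopen_lowerClosure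
    rootSystem := irrFilter_rootSystem }

end PrelinearHilbert

open PrelinearHilbert

/-!
The proof reduces both products to the order theory of finite root systems and p-morphisms.

A morphism `R` of `PHSz` is the same thing as a p-morphism `r` for `≤_d` that pulls the base of
the target back to the base of the source, via `R(x) = {y | r x ≤ y}`
(`PHSzHom.exists_isPMorphism`). A morphism of Esakia root systems is a continuous p-morphism. So
in both categories one looks for the product of the forests `X` and `Y` with respect to
p-morphisms. It exists: a pair of p-morphisms from a root system traces on the chain above each
point a chain in `X × Y`, and the set of all chains of this shape, ordered by reverse
end-extension, has the universal property (`Thread.isForestProduct`). It is finite if `X` and `Y`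
are. In `Esap` the mediating p-morphism is continuous, because the trace at `z` is decided by
finitely many conditions `z ∈ ↓(clopen)` (`IsForestProduct.continuous_of_comp`).

In `PHSz` the product also needs a family `K` on this forest. The smallest candidate is generated
by the preimages of the bases of the factors under `U, V ↦ ↓(U \ V)`. Preimage under p-morphisms
commutes with this operation, so the mediating p-morphism is a morphism of `PHSz`. What has to be
shown is that `K` is a base for the topology of downsets, that is, that it contains every
principal downset, although it is not closed under intersections. This is
`IsForestProduct.inter_Iic_mem`: going down from the maximal elements, all sets `U ∩ ↓a` with
`U ∈ K` belong to `K`. If `a` is covered by `c` and this holds for `c`, then `↓a` is obtained by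
removing from `p⁻¹(↓(p a)) ∩ ↓c` suitable members of `K`, first for the `a` that differ from `c`
in one coordinate only, then for the others; and `U ∩ ↓a` is obtained from `U ∩ ↓c` by removing
the downsets of the other lower covers of `c`.

For finite `H` every principal upset of `X(H)` is a finite intersection of sets `φ(a)`, so `H*`
consists of all upsets and `X(H*)` is isomorphic to `X(H)` as a poset (`Hstar.orderIso`). Hence
the Esakia product of `X(H*)` and `X(G*)` is a finite forest product of `X(H)` and `X(G)`, and
carries the structure above.
-/

namespace PrelinearHilbert

/-! ### Root systems and p-morphisms -/

/-- A root system: the elements above any given element form a chain. -/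
def IsRootSystem (X : Type u) [LE X] : Prop :=
  ∀ x y z : X, x ≤ y → x ≤ z → y ≤ z ∨ z ≤ y

/-- p-morphisms of posets, without any topology. -/
structure IsPMorphism {Z X : Type u} [PartialOrder Z] [PartialOrder X] (f : Z → X) : Prop where
  monotone : Monotone f
  back : ∀ z x, f z ≤ x → ∃ z', z ≤ z' ∧ f z' = x

section

variable {X Y Z P : Type u} [PartialOrder X] [PartialOrder Y] [PartialOrder Z] [PartialOrder P]

theorem IsPMorphism.comp {g : X → Y} {f : Z → X} (hg : IsPMorphism g) (hf : IsPMorphism f) :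
    IsPMorphism (g ∘ f) := by
  refine ⟨hg.monotone.comp hf.monotone, fun z y h => ?_⟩
  obtain ⟨x, hx, rfl⟩ := hg.back _ _ h
  obtain ⟨z', hz, rfl⟩ := hf.back _ _ hx
  exact ⟨z', hz, rfl⟩

theorem _root_.OrderIso.isPMorphism (e : Z ≃o X) : IsPMorphism e :=
  ⟨e.monotone, fun _ x h => ⟨e.symm x, e.le_symm_apply.2 h, e.apply_symm_apply x⟩⟩

theorem IsPMorphism.eq_or_covBy (hP : IsRootSystem P) {f : P → X} (hf : IsPMorphism f) {a b : P}
    (h : a ⋖ b) : f a = f b ∨ f a ⋖ f b := by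
  refine or_iff_not_imp_left.2 fun hne => ⟨(hf.monotone h.le).lt_of_ne hne, fun v hav hvb => ?_⟩
  obtain ⟨d, had, rfl⟩ := hf.back a v hav.le
  have had' : a < d := had.lt_of_ne (by rintro rfl; exact hav.false)
  rcases hP a d b had h.le with hd | hd
  · exact h.2 had' (hd.lt_of_ne (by rintro rfl; exact hvb.false))
  · exact (hf.monotone hd).not_gt hvb

theorem IsPMorphism.isMax {f : P → X} (hf : IsPMorphism f) {a : P} (h : IsMax a) :
    IsMax (f a) := by
  intro x hx
  obtain ⟨b, hb, rfl⟩ := hf.back a x hx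
  exact hf.monotone (h hb)

theorem IsRootSystem.Ici_eq_insert (hP : IsRootSystem P) {a b : P} (h : a ⋖ b) :
    Ici a = insert a (Ici b) := by
  ext d
  constructor
  · intro hd
    rcases hP a d b hd h.le with hdb | hdb
    · rcases h.eq_or_eq hd hdb with rfl | rfl
      · exact Or.inl rfl
      · exact Or.inr le_rfl
    · exact Or.inr hdb
  · rintro (rfl | hd)
    · exact le_refl _
    · exact h.le.trans hd

theorem IsRootSystem.covBy_unique (hX : IsRootSystem X) {d a b c : X} (ha : d ≤ a) (hb : d ≤ b)
    (hac : a ⋖ c) (hbc : b ⋖ c) : a = b := by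
  rcases hX d a b ha hb with h | h
  · exact ((hac.eq_or_eq h hbc.le).resolve_right hbc.ne).symm
  · exact (hbc.eq_or_eq h hac.le).resolve_right hac.ne

/-! ### Products of forests -/

/-- The order-theoretic content of a product of root systems `X` and `Y` with p-morphisms: a root
system `P` with p-morphisms to `X` and `Y` in which a point `a` is determined by the image of
`Ici a` in `X × Y`, and through which every pair of p-morphisms from a root system factors. -/
structure IsForestProduct (p : P → X) (q : P → Y) : Prop where
  rootSystem : IsRootSystem P
  fst : IsPMorphism p
  snd : IsPMorphism q
  ext : ∀ a b, (fun c => (p c, q c)) '' Ici a = (fun c => (p c, q c)) '' Ici b → a = b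
  exists_lift : ∀ (Z : Type u) [PartialOrder Z], IsRootSystem Z → ∀ (f : Z → X) (g : Z → Y),
    IsPMorphism f → IsPMorphism g →
      ∃ h : Z → P, IsPMorphism h ∧ (∀ z, p (h z) = f z) ∧ ∀ z, q (h z) = g z

namespace IsForestProduct

variable {p : P → X} {q : P → Y}

theorem symm (h : IsForestProduct p q) : IsForestProduct q p where
  rootSystem := h.rootSystem
  fst := h.snd
  snd := h.fst
  ext a b hab := h.ext a b (by
    have := congrArg (Prod.swap '' ·) hab
    simpa [image_image] using this)
  exists_lift Z _ hZ f g hf hg := by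
    obtain ⟨k, hk, h₁, h₂⟩ := h.exists_lift Z hZ g f hg hf
    exact ⟨k, hk, h₂, h₁⟩

theorem lift_unique (h : IsForestProduct p q) {k l : Z → P} (hk : IsPMorphism k)
    (hl : IsPMorphism l) (hp : ∀ z, p (k z) = p (l z)) (hq : ∀ z, q (k z) = q (l z)) :
    k = l := by
  have key : ∀ {m : Z → P}, IsPMorphism m → ∀ z,
      (fun c => (p c, q c)) '' Ici (m z) = (fun w => (p (m w), q (m w))) '' Ici z := by
    intro m hm z
    ext c
    constructor
    · rintro ⟨a, ha, rfl⟩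
      obtain ⟨w, hw, rfl⟩ := hm.back z a ha
      exact ⟨w, hw, rfl⟩
    · rintro ⟨w, hw, rfl⟩
      exact ⟨m w, hm.monotone hw, rfl⟩
  funext z
  apply h.ext
  rw [key hk, key hl]
  simp only [hp, hq]

theorem comp_orderIso {X' Y' P' : Type u} [PartialOrder X'] [PartialOrder Y'] [PartialOrder P']
    (h : IsForestProduct p q) (eX : X ≃o X') (eY : Y ≃o Y') (e : P' ≃o P) :
    IsForestProduct (fun a => eX (p (e a))) (fun a => eY (q (e a))) where
  rootSystem x y z hy hz := by
    simpa using h.rootSystem (e x) (e y) (e z) (e.monotone hy) (e.monotone hz)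
  fst := eX.isPMorphism.comp (h.fst.comp e.isPMorphism)
  snd := eY.isPMorphism.comp (h.snd.comp e.isPMorphism)
  ext a b hab := by
    refine e.injective (h.ext _ _ ?_)
    have := congrArg (Prod.map eX.symm eY.symm '' ·) hab
    simp only [image_image, Prod.map_apply, OrderIso.symm_apply_apply] at this
    rw [← e.image_Ici, ← e.image_Ici, image_image, image_image]
    exact this
  exists_lift Z _ hZ f g hf hg := by
    obtain ⟨k, hk, h₁, h₂⟩ := h.exists_lift Z hZ (eX.symm ∘ f) (eY.symm ∘ g)
      (eX.symm.isPMorphism.comp hf) (eY.symm.isPMorphism.comp hg)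
    exact ⟨e.symm ∘ k, e.symm.isPMorphism.comp hk, fun z => by simp [h₁], fun z => by simp [h₂]⟩

theorem eq_of_covBy (h : IsForestProduct p q) {a b c : P} (ha : a ⋖ c) (hb : b ⋖ c)
    (hp : p a = p b) (hq : q a = q b) : a = b := by
  apply h.ext
  rw [h.rootSystem.Ici_eq_insert ha, h.rootSystem.Ici_eq_insert hb, image_insert_eq,
    image_insert_eq, hp, hq]

theorem eq_of_isMax (h : IsForestProduct p q) {a b : P} (ha : IsMax a) (hb : IsMax b)
    (hp : p a = p b) (hq : q a = q b) : a = b := by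
  apply h.ext
  rw [ha.Ici_eq, hb.Ici_eq, image_singleton, image_singleton, hp, hq]

theorem covBy_fst (h : IsForestProduct p q) {a c : P} (ha : a ⋖ c) (hq : q a = q c) :
    p a ⋖ p c := by
  refine (h.fst.eq_or_covBy h.rootSystem ha).resolve_left fun hp => ha.ne (h.ext _ _ ?_)
  rw [h.rootSystem.Ici_eq_insert ha, image_insert_eq, hp, hq]
  exact insert_eq_of_mem ⟨c, le_refl c, rfl⟩

end IsForestProduct

/-! ### Families of downsets closed under `↓(U \ V)` -/

/-- A family of downsets closed under the operation `U, V ↦ ↓(U \ V)`, which is `nhdsKer (U \ V)`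
in the topology of downsets. -/
structure IsDiffClosed (K : Set (Set P)) : Prop where
  isLowerSet : ∀ U ∈ K, IsLowerSet U
  sat_mem : ∀ U ∈ K, ∀ V ∈ K, (lowerClosure (U ∩ Vᶜ) : Set P) ∈ K

namespace IsDiffClosed

variable {K : Set (Set P)}

/-- Finitely many members can be removed at once: since they are downsets,
`↓(↓(U \ V) \ W) = ↓(U \ (V ∪ W))`. -/
theorem lowerClosure_diff_sUnion_mem (hK : IsDiffClosed K) {U : Set P} (hU : U ∈ K)
    {S : Set (Set P)} (hS : S.Finite) (hSK : S ⊆ K) :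
    (lowerClosure (U \ ⋃₀ S) : Set P) ∈ K := by
  induction S, hS using Set.Finite.induction_on with
  | empty =>
    rw [sUnion_empty, sdiff_empty, (hK.isLowerSet U hU).lowerClosure]
    exact hU
  | @insert V S _ _ ih =>
    have hV := hSK (mem_insert V S)
    convert hK.sat_mem _ (ih ((subset_insert V S).trans hSK)) V hV using 1
    ext x
    simp only [SetLike.mem_coe, mem_lowerClosure, sUnion_insert]
    constructor
    · rintro ⟨a, ⟨haU, ha⟩, hxa⟩
      rw [mem_union, not_or] at ha
      exact ⟨a, ⟨⟨a, ⟨haU, ha.2⟩, le_rfl⟩, ha.1⟩, hxa⟩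
    · rintro ⟨b, ⟨⟨a, ⟨haU, ha⟩, hba⟩, hb⟩, hxb⟩
      refine ⟨a, ⟨haU, ?_⟩, hxb.trans hba⟩
      rw [mem_union, not_or]
      exact ⟨fun h => hb (hK.isLowerSet V hV hba h), ha⟩

/-- If `c` is the greatest element of `U \ ⋃₀ S`, which need not be a downset, then
`↓(U \ ⋃₀ S)` is `Iic c`. -/
theorem Iic_mem [Finite P] (hK : IsDiffClosed K) {U : Set P} (hU : U ∈ K) {S : Set (Set P)}
    (hSK : S ⊆ K) {c : P} (hcU : c ∈ U) (hcS : ∀ V ∈ S, c ∉ V)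
    (h : ∀ d ∈ U, (∀ V ∈ S, d ∉ V) → d ≤ c) : Iic c ∈ K := by
  convert hK.lowerClosure_diff_sUnion_mem hU S.toFinite hSK
  ext d
  simp only [SetLike.mem_coe, mem_lowerClosure]
  constructor
  · exact fun hd => ⟨c, ⟨hcU, fun ⟨V, hV, hcV⟩ => hcS V hV hcV⟩, hd⟩
  · rintro ⟨a, ⟨ha, haS⟩, hda⟩
    exact hda.trans (h a ha fun V hV haV => haS ⟨V, hV, haV⟩)

theorem inter_Iic_mem [Finite P] (hK : IsDiffClosed K) {U : Set P} (hU : U ∈ K)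
    {S : Set (Set P)} (hSK : S ⊆ K) {c : P}
    (h : ∀ d ∈ U, d ≤ c ↔ ∀ V ∈ S, d ∉ V) : U ∩ Iic c ∈ K := by
  convert hK.lowerClosure_diff_sUnion_mem hU S.toFinite hSK
  have : U ∩ Iic c = U \ ⋃₀ S := by
    ext d
    refine and_congr_right fun hd => (h d hd).trans ?_
    simp
  rw [← this, ((hK.isLowerSet U hU).inter (isLowerSet_Iic c)).lowerClosure]

end IsDiffClosed

namespace IsForestProduct

variable {p : P → X} {q : P → Y} [Finite P] {K : Set (Set P)}

/-- The step of `Iic_mem` for an element `a` whose cover `c` has the same second coordinate: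
below `c`, the elements with first coordinate below `p a` and second coordinate exactly `q c`
lie below `a`. -/
theorem Iic_mem_of_snd_eq (h : IsForestProduct p q) (hX : IsRootSystem X) (hK : IsDiffClosed K)
    (hp : ∀ x, p ⁻¹' Iic x ∈ K) (hq : ∀ y, q ⁻¹' Iic y ∈ K) {a c : P} (hac : a ⋖ c)
    (hc : ∀ U ∈ K, U ∩ Iic c ∈ K) (hqac : q a = q c) : Iic a ∈ K := by
  refine hK.Iic_mem (S := (fun v => q ⁻¹' Iic v) '' Iio (q c)) (hc _ (hp (p a))) ?_
    ⟨le_rfl, hac.le⟩ ?_ ?_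
  · rintro _ ⟨v, -, rfl⟩
    exact hq v
  · rintro _ ⟨v, hv, rfl⟩ hav
    exact (hqac ▸ hav : q c ≤ v).not_gt hv
  · rintro d ⟨hda, hdc⟩ hd
    have hqd : q d = q c := by
      by_contra hne
      exact hd _ ⟨q d, (h.snd.monotone hdc).lt_of_ne hne, rfl⟩ (le_refl (q d))
    have hpac := h.covBy_fst hac hqac
    have hdc' : d < c := lt_of_le_of_ne hdc (by rintro rfl; exact hpac.lt.not_ge hda)
    obtain ⟨b, hdb, hbc⟩ := exists_le_covBy_of_lt hdc'
    have hqb : q b = q c :=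
      le_antisymm (h.snd.monotone hbc.le) (hqd ▸ h.snd.monotone hdb)
    have hpab : p a = p b :=
      hX.covBy_unique hda (h.fst.monotone hdb) hpac (h.covBy_fst hbc hqb)
    rwa [h.eq_of_covBy hac hbc hpab (hqac.trans hqb.symm)]

/-- The induction step: `Iic a ∈ K` if `a` is covered by `c` and `K` is closed under intersection
with `Iic c`. -/
theorem Iic_mem_of_covBy (h : IsForestProduct p q) (hX : IsRootSystem X) (hY : IsRootSystem Y)
    (hK : IsDiffClosed K) (hp : ∀ x, p ⁻¹' Iic x ∈ K) (hq : ∀ y, q ⁻¹' Iic y ∈ K) {a c : P}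
    (hac : a ⋖ c) (hc : ∀ U ∈ K, U ∩ Iic c ∈ K) : Iic a ∈ K := by
  by_cases hqac : q a = q c
  · exact h.Iic_mem_of_snd_eq hX hK hp hq hac hc hqac
  by_cases hpac : p a = p c
  · exact h.symm.Iic_mem_of_snd_eq hY hK hq hp hac hc hpac
  have hpac' := (h.fst.eq_or_covBy h.rootSystem hac).resolve_left hpac
  have hqac' := (h.snd.eq_or_covBy h.rootSystem hac).resolve_left hqac
  -- Remove the downsets of the lower covers of `c` that move in one coordinate only, and all
  -- elements whose second coordinate is not above `q a`.
  refine hK.Iic_mem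
    (S := Iic '' {b | b ⋖ c ∧ (p b = p c ∨ q b = q c)} ∪ (fun v => q ⁻¹' Iic v) '' {v | ¬ q a ≤ v})
    (hc _ (hp (p a))) ?_ ⟨le_rfl, hac.le⟩ ?_ ?_
  · rintro _ (⟨b, ⟨hb, hpb | hqb⟩, rfl⟩ | ⟨v, -, rfl⟩)
    · exact h.symm.Iic_mem_of_snd_eq hY hK hq hp hb hc hpb
    · exact h.Iic_mem_of_snd_eq hX hK hp hq hb hc hqb
    · exact hq v
  · rintro _ (⟨b, ⟨hb, hpqb⟩, rfl⟩ | ⟨v, hv, rfl⟩) hav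
    · obtain rfl := h.rootSystem.covBy_unique le_rfl hav hac hb
      exact hpqb.elim hpac hqac
    · exact hv hav
  · rintro d ⟨hda, hdc⟩ hd
    have hdc' : d < c := lt_of_le_of_ne hdc (by rintro rfl; exact hpac'.lt.not_ge hda)
    obtain ⟨b, hdb, hbc⟩ := exists_le_covBy_of_lt hdc'
    have hpbc : p b ≠ p c := fun e => hd _ (Or.inl ⟨b, ⟨hbc, Or.inl e⟩, rfl⟩) hdb
    have hqbc : q b ≠ q c := fun e => hd _ (Or.inl ⟨b, ⟨hbc, Or.inr e⟩, rfl⟩) hdb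
    have hpbc' := (h.fst.eq_or_covBy h.rootSystem hbc).resolve_left hpbc
    have hqbc' := (h.snd.eq_or_covBy h.rootSystem hbc).resolve_left hqbc
    have hqad : q a ≤ q d := by
      by_contra hn
      exact hd _ (Or.inr ⟨q d, hn, rfl⟩) (le_refl (q d))
    have hpab := hX.covBy_unique hda (h.fst.monotone hdb) hpac' hpbc'
    have hqab := hY.covBy_unique le_rfl (hqad.trans (h.snd.monotone hdb)) hqac' hqbc'
    rwa [h.eq_of_covBy hac hbc hpab hqab]

/-- The start of the induction: `Iic a` is what remains of `p ⁻¹' Iic (p a)` after the removal of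
the elements whose second coordinate is not above the maximal element `q a`, and the passage to
the generated downset. -/
theorem Iic_mem_of_isMax (h : IsForestProduct p q) (hX : IsRootSystem X)
    (hK : IsDiffClosed K) (hp : ∀ x, p ⁻¹' Iic x ∈ K) (hq : ∀ y, q ⁻¹' Iic y ∈ K) {a : P}
    (ha : IsMax a) : Iic a ∈ K := by
  refine hK.Iic_mem (S := (fun v => q ⁻¹' Iic v) '' {v | ¬ q a ≤ v}) (hp (p a)) ?_ (le_refl (p a))
    ?_ ?_
  · rintro _ ⟨v, -, rfl⟩
    exact hq v
  · rintro _ ⟨v, hv, rfl⟩ hav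
    exact hv hav
  · intro d hda hd
    obtain ⟨b, hdb, hb⟩ := (Ici d).toFinite.exists_le_maximal (le_refl d)
    have hb' : IsMax b := fun e he => hb.2 (hdb.trans he) he
    have hqad : q a ≤ q d := by
      by_contra hn
      exact hd _ ⟨q d, hn, rfl⟩ (le_refl (q d))
    have hqab := (h.snd.isMax ha).eq_of_le (hqad.trans (h.snd.monotone hdb))
    have hpab : p a = p b := by
      rcases hX _ _ _ hda (h.fst.monotone hdb) with hle | hle
      · exact (h.fst.isMax ha).eq_of_le hle
      · exact ((h.fst.isMax hb').eq_of_le hle).symm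
    rwa [h.eq_of_isMax ha hb' hpab hqab]

/-- In a finite product of forests, every family of downsets that contains the preimages of the
principal downsets of the factors and is closed under `↓(U \ V)` contains all sets
`U ∩ Iic a`. The induction runs from the maximal elements downwards. -/
theorem inter_Iic_mem (h : IsForestProduct p q) (hX : IsRootSystem X) (hY : IsRootSystem Y)
    (hK : IsDiffClosed K) (hp : ∀ x, p ⁻¹' Iic x ∈ K) (hq : ∀ y, q ⁻¹' Iic y ∈ K) (a : P) :
    ∀ U ∈ K, U ∩ Iic a ∈ K := by
  induction a using WellFoundedGT.induction with
  | ind a ih =>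
  intro U hU
  by_cases ha : IsMax a
  · refine hK.inter_Iic_mem (S := Iic '' {b | IsMax b ∧ b ≠ a}) hU ?_ fun d _ => ⟨?_, ?_⟩
    · rintro _ ⟨b, ⟨hb, -⟩, rfl⟩
      exact h.Iic_mem_of_isMax hX hK hp hq hb
    · rintro hda _ ⟨b, ⟨hb, hba⟩, rfl⟩ hdb
      rcases h.rootSystem d a b hda hdb with hle | hle
      · exact hba (ha.eq_of_le hle).symm
      · exact hba (hb.eq_of_le hle)
    · intro hd
      obtain ⟨b, hdb, hb⟩ := (Ici d).toFinite.exists_le_maximal (le_refl d)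
      by_contra hda
      refine hd _ ⟨b, ⟨fun e he => hb.2 (hdb.trans he) he, ?_⟩, rfl⟩ hdb
      rintro rfl
      exact hda hdb
  · obtain ⟨e, hae⟩ := not_isMax_iff.1 ha
    obtain ⟨c, hac, -⟩ := exists_covBy_le_of_lt hae
    have hc := ih c hac.lt
    by_cases hcU : c ∈ U
    · have : U ∩ Iic a = Iic a :=
        inter_eq_right.2 fun d hd => hK.isLowerSet U hU (le_trans hd hac.le) hcU
      rw [this]
      exact h.Iic_mem_of_covBy hX hY hK hp hq hac hc
    · have : U ∩ Iic a = (U ∩ Iic c) ∩ Iic a := by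
        rw [inter_assoc, inter_eq_right.2 (Iic_subset_Iic.2 hac.le)]
      rw [this]
      refine hK.inter_Iic_mem (S := Iic '' {b | b ⋖ c ∧ b ≠ a}) (hc U hU) ?_
        fun d hd => ⟨?_, ?_⟩
      · rintro _ ⟨b, ⟨hb, -⟩, rfl⟩
        exact h.Iic_mem_of_covBy hX hY hK hp hq hb hc
      · rintro hda _ ⟨b, ⟨hb, hba⟩, rfl⟩ hdb
        exact hba (h.rootSystem.covBy_unique hdb hda hb hac)
      · intro hdS
        have hdc : d < c := lt_of_le_of_ne hd.2 (by rintro rfl; exact hcU hd.1)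
        obtain ⟨b, hdb, hbc⟩ := exists_le_covBy_of_lt hdc
        by_contra hda
        refine hdS _ ⟨b, ⟨hbc, ?_⟩, rfl⟩ hdb
        rintro rfl
        exact hda hdb

end IsForestProduct

/-! ### The forest of threads -/

/-- A point of the product of two root systems: a chain in `X × Y` with a least element `root`
whose projections to `X` and `Y` are, above each of its members, principal upsets. -/
structure Thread (X Y : Type u) [PartialOrder X] [PartialOrder Y] : Type u where
  carrier : Set (X × Y)
  root : X × Y
  root_mem : root ∈ carrier
  root_le : ∀ c ∈ carrier, root ≤ c
  total : ∀ c ∈ carrier, ∀ d ∈ carrier, c ≤ d ∨ d ≤ c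
  fst_lift : ∀ c ∈ carrier, ∀ x, c.1 ≤ x → ∃ d ∈ carrier, c ≤ d ∧ d.1 = x
  snd_lift : ∀ c ∈ carrier, ∀ y, c.2 ≤ y → ∃ d ∈ carrier, c ≤ d ∧ d.2 = y

namespace Thread

theorem carrier_injective : Function.Injective (carrier : Thread X Y → Set (X × Y)) := by
  intro C D h
  have : C.root = D.root :=
    le_antisymm (C.root_le _ (h ▸ D.root_mem)) (D.root_le _ (h ▸ C.root_mem))
  cases C
  cases D
  congr

instance [Finite X] [Finite Y] : Finite (Thread X Y) := Finite.of_injective _ carrier_injective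

/-- `C ≤ D` when `D` is an upset of `C`. -/
instance : PartialOrder (Thread X Y) where
  le C D := D.carrier ⊆ C.carrier ∧ ∀ d ∈ D.carrier, ∀ c ∈ C.carrier, d ≤ c → c ∈ D.carrier
  le_refl _ := ⟨Subset.rfl, fun _ _ _ hc _ => hc⟩
  le_trans _ _ _ h₁ h₂ := ⟨h₂.1.trans h₁.1, fun e he c hc hec =>
    h₂.2 e he c (h₁.2 e (h₂.1 he) c hc hec) hec⟩
  le_antisymm _ _ h₁ h₂ := carrier_injective (h₂.1.antisymm h₁.1)

theorem isRootSystem : IsRootSystem (Thread X Y) := by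
  intro C D E hD hE
  rcases C.total _ (hD.1 D.root_mem) _ (hE.1 E.root_mem) with h | h
  · have hsub : E.carrier ⊆ D.carrier := fun e he =>
      hD.2 _ D.root_mem e (hE.1 he) (h.trans (E.root_le e he))
    exact Or.inl ⟨hsub, fun e he d hd => hE.2 e he d (hD.1 hd)⟩
  · have hsub : D.carrier ⊆ E.carrier := fun d hd =>
      hE.2 _ E.root_mem d (hD.1 hd) (h.trans (D.root_le d hd))
    exact Or.inr ⟨hsub, fun d hd e he => hD.2 d hd e (hE.1 he)⟩

/-- The part of a thread above one of its members. -/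
def above (C : Thread X Y) (c : X × Y) (hc : c ∈ C.carrier) : Thread X Y where
  carrier := C.carrier ∩ Ici c
  root := c
  root_mem := ⟨hc, le_refl c⟩
  root_le _ hd := hd.2
  total d hd e he := C.total d hd.1 e he.1
  fst_lift d hd x hx := by
    obtain ⟨e, he, hde, rfl⟩ := C.fst_lift d hd.1 x hx
    exact ⟨e, ⟨he, le_trans hd.2 hde⟩, hde, rfl⟩
  snd_lift d hd y hy := by
    obtain ⟨e, he, hde, rfl⟩ := C.snd_lift d hd.1 y hy
    exact ⟨e, ⟨he, le_trans hd.2 hde⟩, hde, rfl⟩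

theorem le_above (C : Thread X Y) (c : X × Y) (hc : c ∈ C.carrier) : C ≤ C.above c hc :=
  ⟨inter_subset_left, fun _ hd _ he hde => ⟨he, le_trans hd.2 hde⟩⟩

theorem root_image_Ici (C : Thread X Y) : root '' Ici C = C.carrier := by
  ext c
  constructor
  · rintro ⟨D, hD, rfl⟩
    exact hD.1 D.root_mem
  · exact fun hc => ⟨C.above c hc, C.le_above c hc, rfl⟩

theorem root_monotone {C D : Thread X Y} (h : C ≤ D) : C.root ≤ D.root :=
  C.root_le _ (h.1 D.root_mem)

/-- The thread of a point `z`, traced by a pair of p-morphisms on the chain above `z`. -/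
def trace (hZ : IsRootSystem Z) {f : Z → X} {g : Z → Y} (hf : IsPMorphism f)
    (hg : IsPMorphism g) (z : Z) : Thread X Y where
  carrier := (fun w => (f w, g w)) '' Ici z
  root := (f z, g z)
  root_mem := ⟨z, le_refl z, rfl⟩
  root_le := by
    rintro _ ⟨w, hw, rfl⟩
    exact ⟨hf.monotone hw, hg.monotone hw⟩
  total := by
    rintro _ ⟨v, hv, rfl⟩ _ ⟨w, hw, rfl⟩
    exact (hZ z v w hv hw).imp (fun h => ⟨hf.monotone h, hg.monotone h⟩)
      fun h => ⟨hf.monotone h, hg.monotone h⟩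
  fst_lift := by
    rintro _ ⟨v, hv, rfl⟩ x hx
    obtain ⟨w, hw, rfl⟩ := hf.back v x hx
    exact ⟨_, ⟨w, le_trans hv hw, rfl⟩, ⟨hf.monotone hw, hg.monotone hw⟩, rfl⟩
  snd_lift := by
    rintro _ ⟨v, hv, rfl⟩ y hy
    obtain ⟨w, hw, rfl⟩ := hg.back v y hy
    exact ⟨_, ⟨w, le_trans hv hw, rfl⟩, ⟨hf.monotone hw, hg.monotone hw⟩, rfl⟩

theorem trace_isPMorphism (hZ : IsRootSystem Z) {f : Z → X} {g : Z → Y} (hf : IsPMorphism f)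
    (hg : IsPMorphism g) : IsPMorphism (trace hZ hf hg) := by
  have hmono : ∀ {v w : Z}, v ≤ w → (f v, g v) ≤ (f w, g w) := fun h =>
    ⟨hf.monotone h, hg.monotone h⟩
  refine ⟨fun z z' hzz' => ⟨image_mono (Ici_subset_Ici.2 hzz'), ?_⟩, fun z D hD => ?_⟩
  · rintro _ ⟨w, hw, rfl⟩ _ ⟨v, hv, rfl⟩ hwv
    rcases hZ z w v (hzz'.trans hw) hv with h | h
    · exact ⟨v, le_trans hw h, rfl⟩
    · exact ⟨w, hw, le_antisymm hwv (hmono h)⟩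
  · obtain ⟨w, hzw, hw⟩ := hD.1 D.root_mem
    refine ⟨w, hzw, carrier_injective (Subset.antisymm ?_ fun d hd => ?_)⟩
    · rintro _ ⟨v, hv, rfl⟩
      exact hD.2 _ D.root_mem _ ⟨v, le_trans hzw hv, rfl⟩ (hw ▸ hmono hv)
    · obtain ⟨v, hzv, rfl⟩ := hD.1 hd
      rcases hZ z w v hzw hzv with h | h
      · exact ⟨v, h, rfl⟩
      · exact ⟨w, le_refl w, le_antisymm (hw ▸ D.root_le _ hd) (hmono h)⟩

theorem isForestProduct :
    IsForestProduct (fun C : Thread X Y => C.root.1) (fun C : Thread X Y => C.root.2) where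
  rootSystem := isRootSystem
  fst := ⟨fun _ _ h => (root_monotone h).1, fun C x hx => by
    obtain ⟨d, hd, -, rfl⟩ := C.fst_lift _ C.root_mem x hx
    exact ⟨C.above d hd, C.le_above d hd, rfl⟩⟩
  snd := ⟨fun _ _ h => (root_monotone h).2, fun C y hy => by
    obtain ⟨d, hd, -, rfl⟩ := C.snd_lift _ C.root_mem y hy
    exact ⟨C.above d hd, C.le_above d hd, rfl⟩⟩
  ext C D h := by
    apply carrier_injective
    rw [← root_image_Ici, ← root_image_Ici]
    exact h
  exists_lift _ _ hZ _ _ hf hg :=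
    ⟨trace hZ hf hg, trace_isPMorphism hZ hf hg, fun _ => rfl, fun _ => rfl⟩

end Thread

end

/-! ### Morphisms of `PHSz` as p-morphisms -/

section

/-- The order `x ≤ y ↔ y ∈ closure {x}` of an object of `PHSz`. -/
instance PHSz.instPartialOrder (X : PHSz.{u}) : PartialOrder X where
  le x y := y ∈ closure {x}
  le_refl _ := subset_closure rfl
  le_trans _ _ _ hxy hyz := closure_minimal (singleton_subset_iff.2 hxy) isClosed_closure hyz
  le_antisymm x y hxy hyx := by
    have := X.isPHSz.t0
    exact (inseparable_iff_mem_closure.2 ⟨hyx, hxy⟩).eq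

variable {X Y Z : PHSz.{u}}

theorem PHSz.le_iff {x y : X} : x ≤ y ↔ y ∈ closure {x} := Iff.rfl

theorem PHSz.isRootSystem (X : PHSz.{u}) : IsRootSystem X := fun x y z hy hz =>
  X.isPHSz.rootSystem x y z hy hz

theorem PHSz.isLowerSet {U : Set X} (hU : U ∈ X.base) : IsLowerSet U := by
  intro y x hxy hy
  obtain ⟨w, hw, rfl⟩ := mem_closure_iff.1 (PHSz.le_iff.1 hxy) U (X.isPHSz.isBasis.isOpen hU) hy
  exact hw

theorem PHSz.nhdsKer_eq (U : Set X) : nhdsKer U = lowerClosure U := by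
  ext x
  rw [mem_nhdsKer_iff_specializes]
  simp only [specializes_iff_mem_closure]
  rfl

theorem PHSz.Iic_mem_base [Finite X] (x : X) : Iic x ∈ X.base := by
  obtain ⟨U, hU, hxU, hUx⟩ := X.isPHSz.isBasis.exists_subset_of_mem_open
    (subset_nhdsKer (mem_singleton x)) isOpen_nhdsKer
  rw [PHSz.nhdsKer_eq, lowerClosure_singleton] at hUx
  have : Iic x = U := (PHSz.isLowerSet hU).Iic_subset hxU |>.antisymm hUx
  rwa [this]

/-- Every `H`-functional relation with nonempty values is `x ↦ {y | r x ≤ y}` for a p-morphism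
`r` that pulls the base of `Y` back to the base of `X`. -/
theorem PHSzHom.exists_isPMorphism (R : PHSzHom X Y) : ∃ r : X → Y, IsPMorphism r ∧
    (∀ U ∈ Y.base, r ⁻¹' U ∈ X.base) ∧ ∀ x y, R.rel x y ↔ r x ≤ y := by
  choose r hr using R.exists_eq_closure
  have hrel : ∀ x y, R.rel x y ↔ r x ≤ y := fun x y => Set.ext_iff.1 (hr x) y
  refine ⟨r, ⟨fun x x' h => (hrel x _).1 (R.anti h ((hrel x' _).2 le_rfl)), ?_⟩, ?_, hrel⟩
  · intro x y hxy
    obtain ⟨z, hz, hzy⟩ := R.isHFunctional.functional x y ((hrel x y).2 hxy)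
    refine ⟨z, hz, le_antisymm ((hrel z y).1 ?_) ?_⟩
    · change y ∈ {w | R.rel z w}
      rw [hzy]
      exact subset_closure rfl
    · exact PHSz.le_iff.2 (hzy ▸ (hrel z (r z)).2 le_rfl)
  · intro U hU
    convert R.isHFunctional.preimage_mem U hU using 1
    ext x
    constructor
    · exact fun hx => ⟨r x, hx, (hrel x _).2 le_rfl⟩
    · rintro ⟨y, hy, hxy⟩
      exact PHSz.isLowerSet hU ((hrel x y).1 hxy) hy

/-- The morphism of `PHSz` given by a p-morphism. -/
def PHSzHom.ofPMorphism (r : X → Y) (hr : IsPMorphism r) (hb : ∀ U ∈ Y.base, r ⁻¹' U ∈ X.base) :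
    PHSzHom X Y where
  rel x y := r x ≤ y
  isHFunctional :=
    { preimage_mem := by
        intro U hU
        convert hb U hU using 1
        ext x
        constructor
        · rintro ⟨y, hy, hxy⟩
          exact PHSz.isLowerSet hU hxy hy
        · exact fun hx => ⟨r x, hx, le_rfl⟩
      isClosed := fun _ => isClosed_closure
      functional := by
        intro x y hxy
        obtain ⟨z, hz, rfl⟩ := hr.back x y hxy
        exact ⟨z, hz, rfl⟩ }
  nonempty x := ⟨r x, le_rfl⟩

theorem PHSzHom.exists_eq_ofPMorphism (R : PHSzHom X Y) : ∃ (r : X → Y) (hr : IsPMorphism r)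
    (hb : ∀ U ∈ Y.base, r ⁻¹' U ∈ X.base), R = PHSzHom.ofPMorphism r hr hb := by
  obtain ⟨r, hr, hb, hrel⟩ := PHSzHom.exists_isPMorphism R
  exact ⟨r, hr, hb, PHSzHom.ext (funext₂ fun x y => propext (hrel x y))⟩

theorem PHSzHom.ofPMorphism_comp {r : X → Y} {s : Y → Z} (hr : IsPMorphism r)
    (hs : IsPMorphism s) (hrb : ∀ U ∈ Y.base, r ⁻¹' U ∈ X.base)
    (hsb : ∀ U ∈ Z.base, s ⁻¹' U ∈ Y.base) :
    (PHSzHom.ofPMorphism r hr hrb).comp (PHSzHom.ofPMorphism s hs hsb) =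
      PHSzHom.ofPMorphism (s ∘ r) (hs.comp hr) fun U hU => hrb _ (hsb U hU) := by
  refine PHSzHom.ext (funext₂ fun x z => propext ⟨?_, fun h => ⟨r x, le_refl (r x), h⟩⟩)
  rintro ⟨y, hxy, hyz⟩
  exact (hs.monotone hxy).trans hyz

theorem PHSzHom.ofPMorphism_inj {r s : X → Y} {hr : IsPMorphism r} {hs : IsPMorphism s}
    {hrb : ∀ U ∈ Y.base, r ⁻¹' U ∈ X.base} {hsb : ∀ U ∈ Y.base, s ⁻¹' U ∈ X.base}
    (h : PHSzHom.ofPMorphism r hr hrb = PHSzHom.ofPMorphism s hs hsb) : r = s := by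
  funext x
  have h' : ∀ y, r x ≤ y ↔ s x ≤ y := fun y =>
    iff_of_eq (congrFun (congrFun (congrArg PHSzHom.rel h) x) y)
  exact le_antisymm ((h' _).2 le_rfl) ((h' _).1 le_rfl)

end

/-! ### Products in `PHSz` -/

/-- The family generated by the preimages of the bases of the factors under `↓(U \ V)`. Dually,
this is the Hilbert subalgebra generated by the two factors. -/
inductive ProdBase {X Y : PHSz.{u}} {P : Type u} [PartialOrder P] (p : P → X) (q : P → Y) :
    Set P → Prop
  | fst {U : Set X} : U ∈ X.base → ProdBase p q (p ⁻¹' U)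
  | snd {U : Set Y} : U ∈ Y.base → ProdBase p q (q ⁻¹' U)
  | sat {U V : Set P} : ProdBase p q U → ProdBase p q V →
      ProdBase p q (lowerClosure (U ∩ Vᶜ) : Set P)

namespace IsForestProduct

variable {X Y : PHSz.{u}} {P : Type u} [PartialOrder P] {p : P → X} {q : P → Y}

theorem isDiffClosed_prodBase (h : IsForestProduct p q) : IsDiffClosed {U | ProdBase p q U} where
  isLowerSet U hU := by
    induction hU with
    | fst hU => exact (PHSz.isLowerSet hU).preimage h.fst.monotone
    | snd hU => exact (PHSz.isLowerSet hU).preimage h.snd.monotone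
    | sat _ _ _ _ => exact LowerSet.lower _
  sat_mem _ hU _ hV := hU.sat hV

/-- If `X` and `Y` are finite, then a finite product of their forests, with the topology of
downsets and the family `ProdBase`, is an object of `PHSz`. -/
theorem isPHSz [Finite X] [Finite Y] [Finite P] (h : IsForestProduct p q) :
    IsPHSz (Topology.lowerSet P) {U | ProdBase p q U} := by
  let _ := Topology.lowerSet P
  have : Topology.IsLowerSet P := ⟨rfl⟩
  have hK := h.isDiffClosed_prodBase
  have huniv : ProdBase p q (univ : Set P) := .fst X.isPHSz.univ_mem
  have hcl : ∀ x y : P, y ∈ closure {x} ↔ x ≤ y := fun x y => by simp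
  have hIic : ∀ a : P, ProdBase p q (Iic a) := fun a => by
    have := h.inter_Iic_mem X.isRootSystem Y.isRootSystem hK
      (fun x => .fst (PHSz.Iic_mem_base x)) (fun y => .snd (PHSz.Iic_mem_base y)) a _ huniv
    rwa [univ_inter] at this
  have hT0 : T0Space P := ⟨fun x y hxy => by
    rw [inseparable_iff_mem_closure, hcl, hcl] at hxy
    exact le_antisymm hxy.2 hxy.1⟩
  refine ⟨⟨?_, fun U _ => U.toFinite.isCompact, ?_, hT0, ?_⟩, ?_, huniv⟩
  · refine isTopologicalBasis_of_isOpen_of_nhds (fun U hU => hK.isLowerSet U hU) ?_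
    exact fun a U ha hU => ⟨Iic a, hIic a, le_refl a, IsLowerSet.Iic_subset hU ha⟩
  · intro U hU V hV
    change ProdBase p q _
    convert ProdBase.sat hU hV
    ext x
    rw [mem_nhdsKer_iff_specializes]
    simp only [specializes_iff_mem_closure, hcl]
    rfl
  · refine ⟨fun {S} hS hSc => ?_⟩
    -- A minimal element of a finite irreducible closed set is its generic point.
    obtain ⟨a, ha⟩ := S.toFinite.exists_minimal hS.1
    refine ⟨a, Subset.antisymm (closure_minimal (singleton_subset_iff.2 ha.1) hSc) ?_⟩
    intro b hb
    rw [hcl]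
    obtain ⟨c, hc, hca, hcb⟩ := hS.2 (Iic a) (Iic b) (hK.isLowerSet _ (hIic a))
      (hK.isLowerSet _ (hIic b)) ⟨a, ha.1, le_refl a⟩ ⟨b, hb, le_refl b⟩
    exact (ha.2 hc hca).trans hcb
  · intro x y z hy hz
    rw [hcl] at *
    rw [hcl]
    exact h.rootSystem x y z hy hz

variable [Finite X] [Finite Y] [Finite P]

/-- The object of `PHSz` on a finite forest product. -/
def toPHSz (h : IsForestProduct p q) : PHSz.{u} :=
  ⟨P, Topology.lowerSet P, {U | ProdBase p q U}, h.isPHSz⟩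

/-- The identity, from `P` with its given order to `P` with the order `≤_d`. -/
def orderIsoToPHSz (h : IsForestProduct p q) : P ≃o h.toPHSz where
  toEquiv := Equiv.refl P
  map_rel_iff' {x y} := by
    let _ := Topology.lowerSet P
    have : Topology.IsLowerSet P := ⟨rfl⟩
    change y ∈ closure {x} ↔ x ≤ y
    simp

/-- The first projection of `toPHSz`. -/
def homFst (h : IsForestProduct p q) : PHSzHom h.toPHSz X :=
  PHSzHom.ofPMorphism p (h.fst.comp h.orderIsoToPHSz.symm.isPMorphism) fun _ hU => .fst hU

/-- The second projection of `toPHSz`. -/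
def homSnd (h : IsForestProduct p q) : PHSzHom h.toPHSz Y :=
  PHSzHom.ofPMorphism q (h.snd.comp h.orderIsoToPHSz.symm.isPMorphism) fun _ hU => .snd hU

/-- The fan of the two projections of `toPHSz`. -/
def fan (h : IsForestProduct p q) : BinaryFan X Y :=
  BinaryFan.mk (P := h.toPHSz) h.homFst h.homSnd

theorem nonempty_isLimit_fan (h : IsForestProduct p q) : Nonempty (IsLimit h.fan) := by
  have key : ∀ (T : PHSz.{u}) (R : PHSzHom T X) (S : PHSzHom T Y),
      ∃ M : PHSzHom T h.toPHSz, M.comp h.homFst = R ∧ M.comp h.homSnd = S ∧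
        ∀ N : PHSzHom T h.toPHSz, N.comp h.homFst = R → N.comp h.homSnd = S → N = M := by
    intro T R S
    obtain ⟨f, hf, hfb, rfl⟩ := PHSzHom.exists_eq_ofPMorphism R
    obtain ⟨g, hg, hgb, rfl⟩ := PHSzHom.exists_eq_ofPMorphism S
    obtain ⟨m, hm, hmp, hmq⟩ := h.exists_lift T T.isRootSystem f g hf hg
    have hmb : ∀ U, ProdBase p q U → m ⁻¹' U ∈ T.base := by
      intro U hU
      induction hU with
      | @fst U hU =>
        rw [← preimage_comp, show p ∘ m = f from funext hmp]
        exact hfb U hU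
      | @snd U hU =>
        rw [← preimage_comp, show q ∘ m = g from funext hmq]
        exact hgb U hU
      | @sat U V _ _ ihU ihV =>
        -- Preimages under p-morphisms commute with the generation of downsets.
        convert T.isPHSz.sat_mem _ ihU _ ihV
        rw [PHSz.nhdsKer_eq]
        ext z
        constructor
        · rintro ⟨a, ha, hza⟩
          obtain ⟨w, hzw, rfl⟩ := hm.back z a hza
          exact ⟨w, ha, hzw⟩
        · rintro ⟨w, hw, hzw⟩
          exact ⟨m w, hw, hm.monotone hzw⟩
    refine ⟨PHSzHom.ofPMorphism (Y := h.toPHSz) m (h.orderIsoToPHSz.isPMorphism.comp hm) hmb,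
      ?_, ?_, ?_⟩
    · refine (PHSzHom.ofPMorphism_comp _ _ _ _).trans ?_
      congr 1
      exact funext hmp
    · refine (PHSzHom.ofPMorphism_comp _ _ _ _).trans ?_
      congr 1
      exact funext hmq
    · intro N hN₁ hN₂
      obtain ⟨n, hn, hnb, rfl⟩ := PHSzHom.exists_eq_ofPMorphism N
      have h₁ : p ∘ n = f :=
        PHSzHom.ofPMorphism_inj ((PHSzHom.ofPMorphism_comp hn _ hnb _).symm.trans hN₁)
      have h₂ : q ∘ n = g :=
        PHSzHom.ofPMorphism_inj ((PHSzHom.ofPMorphism_comp hn _ hnb _).symm.trans hN₂)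
      have : n = m := h.lift_unique (k := n) (h.orderIsoToPHSz.symm.isPMorphism.comp hn) hm
        (fun z => (congrFun h₁ z).trans (hmp z).symm) (fun z => (congrFun h₂ z).trans (hmq z).symm)
      subst this
      rfl
  choose M h₁ h₂ h₃ using key
  exact ⟨BinaryFan.IsLimit.mk _ (fun {T} R S => M T R S) (fun {T} R S => h₁ T R S)
    (fun {T} R S => h₂ T R S) fun {T} R S N => h₃ T R S N⟩

end IsForestProduct

/-! ### Products of finite Esakia root systems -/

section

variable {X Y : Esap.{u}}

theorem Esap.isRootSystem (X : Esap.{u}) : IsRootSystem X := X.rootSystem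

theorem Esap.isPMorphism (f : X ⟶ Y) : IsPMorphism (EsakiaHom.toContinuousOrderHom f) :=
  ⟨(EsakiaHom.toContinuousOrderHom f).monotone', fun _ _ h =>
    EsakiaHom.exists_map_eq_of_map_le' f h⟩

/-- The Esakia space of a finite root system, with the discrete topology. -/
def Esap.ofFinite (T : Type u) [PartialOrder T] [Finite T] (hT : IsRootSystem T) : Esap.{u} :=
  letI : TopologicalSpace T := ⊥
  haveI : DiscreteTopology T := ⟨rfl⟩
  { carrier := T
    priestley := ⟨fun {x _} h => ⟨Ici x, isClopen_discrete _, isUpperSet_Ici x, le_refl x, h⟩⟩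
    isClopen_lowerClosure := fun _ _ => isClopen_discrete _
    rootSystem := hT }

/-- A continuous p-morphism from a p-morphism between the underlying posets. -/
def Esap.homMk (f : X → Y) (hf : IsPMorphism f) (hc : Continuous f) : X ⟶ Y :=
  show EsakiaHom X Y from
    { toFun := f, monotone' := hf.monotone, continuous_toFun := hc
      exists_map_eq_of_map_le' := fun {a b} h => hf.back a b h }

@[ext]
theorem Esap.hom_ext {f g : X ⟶ Y}
    (h : ∀ x, EsakiaHom.toContinuousOrderHom f x = EsakiaHom.toContinuousOrderHom g x) : f = g :=
  EsakiaHom.ext h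

end

namespace IsForestProduct

variable {X Y : Esap.{u}} [Finite X] [Finite Y] {P : Type u} [PartialOrder P]
  {p : P → X} {q : P → Y}

theorem continuous_of_comp (h : IsForestProduct p q) {Z : Esap.{u}} {k : Z → P}
    (hk : IsPMorphism k) (hp : Continuous fun z => p (k z)) (hq : Continuous fun z => q (k z)) :
    @Continuous Z P _ ⊥ k := by
  let _ : TopologicalSpace P := ⊥
  have : DiscreteTopology P := ⟨rfl⟩
  -- `k z` is determined by the set of points of `X × Y` in whose fibre some `w ≥ z` lies,
  -- and each such condition on `z` is clopen, being the downset of a clopen set.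
  let F : X × Y → Set Z := fun c => (lowerClosure {w | (p (k w), q (k w)) = c} : Set Z)
  have hF : ∀ c, IsClopen (F c) := fun c => by
    have hc : IsClopen ({c} : Set (X × Y)) := isClopen_discrete _
    exact Z.isClopen_lowerClosure _ (hc.preimage (hp.prodMk hq))
  have himg : ∀ z, (fun a => (p a, q a)) '' Ici (k z) = {c | z ∈ F c} := by
    intro z
    ext c
    constructor
    · rintro ⟨a, ha, rfl⟩
      obtain ⟨w, hzw, rfl⟩ := hk.back z a ha
      exact ⟨w, rfl, hzw⟩
    · rintro ⟨w, rfl, hzw⟩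
      exact ⟨k w, hk.monotone hzw, rfl⟩
  rw [continuous_iff_continuousAt]
  intro z
  rw [ContinuousAt, nhds_discrete P, Filter.tendsto_pure]
  have hev : ∀ c, ∀ᶠ w in 𝓝 z, (w ∈ F c ↔ z ∈ F c) := by
    intro c
    by_cases hz : z ∈ F c
    · filter_upwards [(hF c).isOpen.mem_nhds hz] with w hw using iff_of_true hw hz
    · filter_upwards [(hF c).compl.isOpen.mem_nhds hz] with w hw using iff_of_false hw hz
  filter_upwards [Filter.eventually_all.2 hev] with w hw
  apply h.ext
  rw [himg, himg]
  exact Set.ext hw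

variable [Finite P]

/-- A finite forest product with the discrete topology, as a fan of Esakia root systems. -/
def esapFan (h : IsForestProduct p q) : BinaryFan X Y :=
  BinaryFan.mk (P := Esap.ofFinite P h.rootSystem)
    (Esap.homMk (X := Esap.ofFinite P h.rootSystem) p h.fst continuous_bot)
    (Esap.homMk (X := Esap.ofFinite P h.rootSystem) q h.snd continuous_bot)

theorem nonempty_isLimit_esapFan (h : IsForestProduct p q) : Nonempty (IsLimit h.esapFan) := by
  have key : ∀ (T : Esap.{u}) (f : T ⟶ X) (g : T ⟶ Y),
      ∃ m : T ⟶ Esap.ofFinite P h.rootSystem, m ≫ h.esapFan.fst = f ∧ m ≫ h.esapFan.snd = g ∧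
        ∀ n : T ⟶ Esap.ofFinite P h.rootSystem,
          n ≫ h.esapFan.fst = f → n ≫ h.esapFan.snd = g → n = m := by
    intro T f g
    obtain ⟨m, hm, hmp, hmq⟩ := h.exists_lift T T.isRootSystem _ _ (Esap.isPMorphism f)
      (Esap.isPMorphism g)
    have hc : @Continuous T P _ ⊥ m := h.continuous_of_comp hm
      ((funext hmp) ▸ (EsakiaHom.toContinuousOrderHom f).continuous_toFun)
      ((funext hmq) ▸ (EsakiaHom.toContinuousOrderHom g).continuous_toFun)
    refine ⟨Esap.homMk (Y := Esap.ofFinite P h.rootSystem) m hm hc, ?_, ?_, ?_⟩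
    · exact Esap.hom_ext hmp
    · exact Esap.hom_ext hmq
    · rintro n rfl rfl
      have := h.lift_unique (Esap.isPMorphism n) hm (fun z => (hmp z).symm) fun z => (hmq z).symm
      exact Esap.hom_ext (congrFun this)
  choose M h₁ h₂ h₃ using key
  exact ⟨BinaryFan.IsLimit.mk _ (fun {T} f g => M T f g) (fun {T} f g => h₁ T f g)
    (fun {T} f g => h₂ T f g) fun {T} f g n => h₃ T f g n⟩

end IsForestProduct

/-- An isomorphism of Esakia root systems is an order isomorphism. -/
def Esap.orderIsoOfIso {X Y : Esap.{u}} (e : X ≅ Y) : X ≃o Y where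
  toFun := EsakiaHom.toContinuousOrderHom e.hom
  invFun := EsakiaHom.toContinuousOrderHom e.inv
  left_inv x := congrArg (fun f : X ⟶ X => EsakiaHom.toContinuousOrderHom f x) e.hom_inv_id
  right_inv x := congrArg (fun f : Y ⟶ Y => EsakiaHom.toContinuousOrderHom f x) e.inv_hom_id
  map_rel_iff' {x y} := by
    refine ⟨fun h => ?_, fun h => (Esap.isPMorphism e.hom).monotone h⟩
    have h' := (Esap.isPMorphism e.inv).monotone h
    have hinv : ∀ z, EsakiaHom.toContinuousOrderHom e.inv
        (EsakiaHom.toContinuousOrderHom e.hom z) = z := fun z =>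
      congrArg (fun f : X ⟶ X => EsakiaHom.toContinuousOrderHom f z) e.hom_inv_id
    exact (hinv x) ▸ (hinv y) ▸ h'

/-- A product of finite Esakia root systems in `Esap` is a finite forest product, since the
threads form one. -/
theorem Esap.finite_and_isForestProduct {X Y : Esap.{u}} [Finite X] [Finite Y]
    (P : BinaryFan X Y) (hP : IsLimit P) : Finite P.pt ∧
      IsForestProduct (EsakiaHom.toContinuousOrderHom P.fst : P.pt → X)
        (EsakiaHom.toContinuousOrderHom P.snd : P.pt → Y) := by
  have hT := Thread.isForestProduct (X := X) (Y := Y)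
  obtain ⟨hlim⟩ := hT.nonempty_isLimit_esapFan
  let i := hP.conePointUniqueUpToIso hlim
  let e : P.pt ≃o Thread X Y := Esap.orderIsoOfIso i
  refine ⟨Finite.of_equiv _ e.symm.toEquiv, ?_⟩
  have h₁ : i.hom ≫ hT.esapFan.fst = P.fst :=
    hP.conePointUniqueUpToIso_hom_comp hlim ⟨WalkingPair.left⟩
  have h₂ : i.hom ≫ hT.esapFan.snd = P.snd :=
    hP.conePointUniqueUpToIso_hom_comp hlim ⟨WalkingPair.right⟩
  rw [← h₁, ← h₂]
  exact hT.comp_orderIso (OrderIso.refl X) (OrderIso.refl Y) e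

/-! ### The Esakia space of `H*` for finite `H` -/

section

variable {H : Type u} [HilbertAlgebra H]

theorem InHstar.inter_phi_of_finite {s : Set H} (hs : s.Finite) :
    InHstar H {Q | ∀ a ∈ s, a ∈ Q.1} := by
  induction s, hs using Set.Finite.induction_on with
  | empty => simpa using InHstar.univ
  | @insert a s _ _ ih =>
    convert (InHstar.basic a).inter ih
    ext Q
    simp [phi]

theorem Hstar.exists_mem_of_sup_mem (F : IrrFilter (Hstar H)) (s : Finset (Hstar H))
    (h : s.sup id ∈ F.1) : ∃ U ∈ s, U ∈ F.1 := by
  classical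
  induction s using Finset.induction_on with
  | empty => exact (irr_bot F h).elim
  | insert U s _ ih =>
    rw [Finset.sup_insert] at h
    rcases (irr_sup F).1 h with hU | hs
    · exact ⟨U, Finset.mem_insert_self U s, hU⟩
    · obtain ⟨V, hV, hVF⟩ := ih hs
      exact ⟨V, Finset.mem_insert_of_mem hV, hVF⟩

variable [Finite H]

/-- The principal upset of a point of `X(H)` belongs to `H*`, for finite `H`. -/
def Hstar.principal (P : IrrFilter H) : Hstar H :=
  ⟨{Q | P ≤ Q}, InHstar.inter_phi_of_finite P.1.toFinite⟩

instance : Finite (Hstar H) := inferInstanceAs (Finite {U : Set (IrrFilter H) // InHstar H U})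

/-- The prime filter of the members of `H*` that contain a given point of `X(H)`. -/
def Hstar.pointFilter (P : IrrFilter H) : IrrFilter (Hstar H) :=
  ⟨{U | P ∈ U.1}, (isIrreducibleFilter_iff_prime _).2
    ⟨⟨mem_univ P, fun _ _ hUV hP => hUV hP, fun _ _ hU hV => ⟨hU, hV⟩⟩, fun h => h,
      fun _ _ h => h⟩⟩

theorem Hstar.pointFilter_le_iff {P Q : IrrFilter H} :
    Hstar.pointFilter P ≤ Hstar.pointFilter Q ↔ P ≤ Q :=
  ⟨fun h => h (show Hstar.principal P ∈ (Hstar.pointFilter P).1 from le_refl P),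
    fun h U hU => U.2.isUpperSet h hU⟩

/-- A prime filter of the finite algebra `H*` has a least member, which is a finite union of
principal upsets; by primeness it is a principal upset. -/
theorem Hstar.pointFilter_surjective : Function.Surjective (Hstar.pointFilter (H := H)) := by
  classical
  intro F
  obtain ⟨U, hU⟩ := F.1.toFinite.exists_minimal ⟨⊤, F.2.1.1⟩
  have hUle : ∀ V ∈ F.1, U ≤ V := fun V hV =>
    (hU.2 ((irr_inf F).2 ⟨hU.1, hV⟩) inf_le_left).trans inf_le_right
  let s : Finset (Hstar H) := (Hstar.principal '' U.1).toFinite.toFinset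
  have hs : U ≤ s.sup id := fun P hP => by
    have hPs : Hstar.principal P ≤ s.sup id :=
      Finset.le_sup (f := id) ((Set.Finite.mem_toFinset _).2 ⟨P, hP, rfl⟩)
    exact hPs (show P ∈ (Hstar.principal P).1 from le_refl P)
  obtain ⟨V, hV, hVF⟩ := Hstar.exists_mem_of_sup_mem F s (irr_mono F hs hU.1)
  obtain ⟨P, hPU, rfl⟩ := (Set.Finite.mem_toFinset _).1 hV
  refine ⟨P, Subtype.ext (Set.ext fun W => ⟨fun hPW => ?_, fun hW => hUle W hW hPU⟩)⟩
  exact irr_mono F (show Hstar.principal P ≤ W from fun Q hPQ => W.2.isUpperSet hPQ hPW) hVF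

/-- For finite `H` the posets `X(H)` and `X(H*)` are isomorphic. -/
noncomputable def Hstar.orderIso : IrrFilter H ≃o IrrFilter (Hstar H) where
  toEquiv := Equiv.ofBijective Hstar.pointFilter
    ⟨fun _ _ h => le_antisymm (Hstar.pointFilter_le_iff.1 h.le) (Hstar.pointFilter_le_iff.1 h.ge),
      Hstar.pointFilter_surjective⟩
  map_rel_iff' := Hstar.pointFilter_le_iff

end

/-- The identity, from `X(H)` ordered by inclusion to `X(H)` with the order `≤_d`. -/
def PHSz.orderIsoOfHilbert (H : Type u) [BoundedHilbertAlgebra H] [IsPrelinear H] :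
    IrrFilter H ≃o PHSz.ofHilbert H where
  toEquiv := Equiv.refl _
  map_rel_iff' {P Q} := mem_closure_singleton_iff P Q

end PrelinearHilbert

theorem mainTheorem9 (H G : Type u)
    [BoundedHilbertAlgebra H] [IsPrelinear H] [Finite H]
    [BoundedHilbertAlgebra G] [IsPrelinear G] [Finite G] :
    HasBinaryProduct (Esap.ofHeyting (Hstar H)) (Esap.ofHeyting (Hstar G)) ∧
    HasBinaryProduct (PHSz.ofHilbert H) (PHSz.ofHilbert G) ∧
    ∀ P : BinaryFan (Esap.ofHeyting (Hstar H)) (Esap.ofHeyting (Hstar G)), IsLimit P →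
      ∃ (τ : TopologicalSpace P.pt.carrier) (K : Set (Set P.pt.carrier)) (h : IsPHSz τ K),
        (∀ U : Set P.pt.carrier, IsOpen[τ] U ↔ IsLowerSet U) ∧
        ∀ Q : BinaryFan (PHSz.ofHilbert H) (PHSz.ofHilbert G), IsLimit Q →
          Nonempty (Q.pt ≅ PHSz.mk P.pt.carrier τ K h) := by
  have : Finite (Esap.ofHeyting (Hstar H)) := inferInstanceAs (Finite (IrrFilter (Hstar H)))
  have : Finite (Esap.ofHeyting (Hstar G)) := inferInstanceAs (Finite (IrrFilter (Hstar G)))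
  have : Finite (PHSz.ofHilbert H) := inferInstanceAs (Finite (IrrFilter H))
  have : Finite (PHSz.ofHilbert G) := inferInstanceAs (Finite (IrrFilter G))
  refine ⟨?_, ?_, fun P hP => ?_⟩
  · obtain ⟨hlim⟩ := (Thread.isForestProduct (X := Esap.ofHeyting (Hstar H))
      (Y := Esap.ofHeyting (Hstar G))).nonempty_isLimit_esapFan
    exact ⟨⟨⟨_, hlim⟩⟩⟩
  · obtain ⟨hlim⟩ := (Thread.isForestProduct (X := PHSz.ofHilbert H)
      (Y := PHSz.ofHilbert G)).nonempty_isLimit_fan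
    exact ⟨⟨⟨_, hlim⟩⟩⟩
  · obtain ⟨_, hprod⟩ := Esap.finite_and_isForestProduct P hP
    let eH : Esap.ofHeyting (Hstar H) ≃o PHSz.ofHilbert H :=
      Hstar.orderIso.symm.trans (PHSz.orderIsoOfHilbert H)
    let eG : Esap.ofHeyting (Hstar G) ≃o PHSz.ofHilbert G :=
      Hstar.orderIso.symm.trans (PHSz.orderIsoOfHilbert G)
    have h := hprod.comp_orderIso eH eG (OrderIso.refl P.pt)
    obtain ⟨hlim⟩ := h.nonempty_isLimit_fan
    exact ⟨_, _, h.isPHSz, fun U => Iff.rfl, fun Q hQ => ⟨hQ.conePointUniqueUpToIso hlim⟩⟩
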